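/- Let $(\Upsilon,\preccurlyeq)$ be a tree, i.e. a partially ordered set in which $\{s : s\preccurlyeq t\}$ is well-ordered for every $t$. Assume that $\Upsilon$ is Hausdorff: whenever $\{s: s\prec t\}$ has order type a (non-zero) limit ordinal and $\{s: s\prec t'\}=\{s: s\prec t\}$, then $t=t'$. Equip $\Upsilon$ with the coarsest topology for which all sets $\{s: s\preccurlyeq t\}$ $(t\in\Upsilon)$ are open and closed, and let $C_0(\Upsilon)$ be the Banach space of continuous functions $f:\Upsilon\to\mathbb R$ such that $\{t:|f(t)|\ge\varepsilon\}$ is compact for every $\varepsilon>0$, with the supremum norm. A norm $\|\cdot\|$ on a Banach space is *locally uniformly convex* (LUR) if $\|x_n\|\to\|x\|$ and $\|x+x_n\|\to 2\|x\|$ together imply $\|x-x_n\|\to 0$; it is *weakly locally uniformly convex* if the same hypotheses imply that $x_n\to x$ weakly. A subset $\Gamma\subseteq\Upsilon$ is *ever-branching* if, for every $t\in\Gamma$, the set $\{u\in\Gamma: t\preccurlyeq u\}$ is not totally ordered. A function $\rho:\Upsilon\to\mathbb R$ is *increasing* if $s\preccurlyeq t$ implies $\rho(s)\le\rho(t)$.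 Let $t^+$ denote the set of immediate successors of $t$; a point $t\in\Upsilon$ is *good* for $\rho$ if there is a finite set $F\subseteq t^+$ with $\inf_{u\in t^+\setminus F}\rho(u)>\rho(t)$ (where $\inf\emptyset=+\infty$), and *bad* for $\rho$ otherwise. **Theorem 4.1.** The following are equivalent: 1. there exists a norm on $C_0(\Upsilon)$, equivalent to the supremum norm, which is locally uniformly convex; 2. there exists a norm on $C_0(\Upsilon)$, equivalent to the supremum norm, which is weakly locally uniformly convex; 3. there exists an increasing function $\rho:\Upsilon\to\mathbb R$ which is constant on no non-empty ever-branching subset of $\Upsilon$ and which has no bad points. -/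

import Mathlib

open Filter Topology
open scoped ZeroAtInfty

/-- A tree: a partially ordered set in which, for every `t`, the set `{s | s ≤ t}` is well-ordered.
The tree is moreover required to be Hausdorff: if the order type of `{s | s < t}` is a (non-zero)
limit ordinal, then `t` is determined by the set of its strict predecessors.  In a tree,
`Order.IsSuccLimit t` says exactly that `{s | s < t}` is non-empty and has no greatest element,
that is to say that its order type is a limit ordinal.  Several minimal elements are allowed. -/
class IsHausdorffTree (Υ : Type*) [PartialOrder Υ] : Prop where
  isWellOrder_Iic : ∀ t : Υ, IsWellOrder (Set.Iic t) (· < ·)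
  eq_of_Iio_eq : ∀ t t' : Υ, Order.IsSuccLimit t → Set.Iio t' = Set.Iio t → t = t'

/-- The locally compact topology of a tree: the coarsest topology for which all the sets
`(0, t] = {s | s ≤ t}` are open and closed. -/
abbrev treeTopology (Υ : Type*) [PartialOrder Υ] : TopologicalSpace Υ :=
  TopologicalSpace.generateFrom {U | ∃ t : Υ, U = Set.Iic t ∨ U = (Set.Iic t)ᶜ}

/-- The topological space `Υ` carries the locally compact topology of the tree `Υ`. -/
class HasTreeTopology (Υ : Type*) [PartialOrder Υ] [T : TopologicalSpace Υ] : Prop where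
  topology_eq : T = treeTopology Υ

/-- A subset `Γ` of a tree is ever-branching if for no `t ∈ Γ` the intersection of `Γ` with
`[t, ∞)` is totally ordered. -/
def IsEverBranching {Υ : Type*} [PartialOrder Υ] (Γ : Set Υ) : Prop :=
  ∀ t ∈ Γ, ¬ IsChain (· ≤ ·) (Γ ∩ Set.Ici t)

/-- The set `t⁺` of immediate successors of `t`. -/
def immediateSuccessors {Υ : Type*} [PartialOrder Υ] (t : Υ) : Set Υ := {u | t ⋖ u}

/-- `t` is a good point for `ρ` if there is a finite subset `F` of `t⁺` such that the infimum of
`ρ` over `t⁺ \ F` is strictly larger than `ρ t` (the infimum over the empty set being `+∞`). -/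
def IsGoodPoint {Υ : Type*} [PartialOrder Υ] (ρ : Υ → ℝ) (t : Υ) : Prop :=
  ∃ F : Set Υ, F ⊆ immediateSuccessors t ∧ F.Finite ∧
    ∃ δ : ℝ, 0 < δ ∧ ∀ u ∈ immediateSuccessors t \ F, ρ t + δ ≤ ρ u

/-- A bad point for `ρ` is a point that is not good. -/
def IsBadPoint {Υ : Type*} [PartialOrder Υ] (ρ : Υ → ℝ) (t : Υ) : Prop := ¬ IsGoodPoint ρ t

section Renorming

variable {X : Type*} [NormedAddCommGroup X] [NormedSpace ℝ X]

/-- `N` is a norm on `X` equivalent to the given one (a renorming of `X`). -/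
def IsEquivalentNorm (N : Seminorm ℝ X) : Prop :=
  ∃ c C : ℝ, 0 < c ∧ 0 < C ∧ ∀ x : X, c * ‖x‖ ≤ N x ∧ N x ≤ C * ‖x‖

/-- `N` is locally uniformly convex (LUR): if `N (xₙ) → N x` and `N (x + xₙ) → 2 N x` then
`N (x - xₙ) → 0`. -/
def IsLUR (N : Seminorm ℝ X) : Prop :=
  ∀ (x : X) (y : ℕ → X),
    Tendsto (fun n => N (y n)) atTop (𝓝 (N x)) →
    Tendsto (fun n => N (x + y n)) atTop (𝓝 (2 * N x)) →
    Tendsto (fun n => N (x - y n)) atTop (𝓝 0)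

/-- `N` is weakly locally uniformly convex (wLUR): if `N (xₙ) → N x` and `N (x + xₙ) → 2 N x`
then `xₙ → x` weakly.  (For `N` equivalent to the given norm, both define the same dual.) -/
def IsWeaklyLUR (N : Seminorm ℝ X) : Prop :=
  ∀ (x : X) (y : ℕ → X),
    Tendsto (fun n => N (y n)) atTop (𝓝 (N x)) →
    Tendsto (fun n => N (x + y n)) atTop (𝓝 (2 * N x)) →
    ∀ φ : StrongDual ℝ X, Tendsto (fun n => φ (y n)) atTop (𝓝 (φ x))

end Renorming

/-! ### Order structure of Hausdorff trees: meets and immediate successors. -/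

section TreeOrder

variable {Υ : Type*} [PartialOrder Υ] [IsHausdorffTree Υ]

/-! From (2) to (3). Given an equivalent norm `N`, let μ(t) = `extensionInf N t` be the infimum of
`N` over the functions that are 1 on {s ≤ t} and vanish at all points incomparable with t; it
increases with t. If t is bad for μ, near-minimisers chosen at many immediate successors of t differ
from the indicator χ_t by functions with disjoint supports, so their averages tend to χ_t and N(χ_t)
= μ(t) (`apply_treeChi_le_of_isBadPoint`). If μ is constant on an ever-branching set, iterated
averaging over pairs of incomparable points is a contraction and yields minimisers, which
contradicts strict convexity (`extensionInf_not_constant_of_isEverBranching`). Weak LUR at χ_t puts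
a rational between μ(t) and the values of μ at earlier bad points. Summable weights on these
rationals give an increasing σ that jumps just after each bad point, and ρ = μ + σ is as required.

From (3) to (1). Goodness leaves each t only finitely many immediate successors u on its own level
of ρ. The functionals f(t) - ∑ f(u), together with evaluations at points where ρ jumps across a
rational, fall into countably many families, each mapping into c₀. As ρ is constant on no
ever-branching set, every f lies in the closed span of the indicators of meets of points where these
functionals do not vanish on f, or of immediate predecessors of such points
(`mem_closure_span_of_functionals`). This is the input of a general renorming criterion,
`exists_isEquivalentNorm_isLUR`: seminorms attached to finite index sets G are combined with ∑_{γ ∈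
G} |T γ x|, and near-maximality at x + y then singles out the set of large coordinates of x. -/

theorem tree_total {s s' t : Υ} (h : s ≤ t) (h' : s' ≤ t) : s ≤ s' ∨ s' ≤ s := by
  have := IsHausdorffTree.isWellOrder_Iic t
  rcases trichotomous_of (· < ·) (⟨s, h⟩ : Set.Iic t) ⟨s', h'⟩ with h1 | h1 | h1
  · exact Or.inl (le_of_lt h1)
  · exact Or.inl (le_of_eq (congrArg Subtype.val h1))
  · exact Or.inr (le_of_lt h1)

theorem tree_wellFounded : WellFounded ((· < ·) : Υ → Υ → Prop) := by
  refine ⟨fun t => ?_⟩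
  have hw := IsHausdorffTree.isWellOrder_Iic t
  have key : ∀ a : Set.Iic t, Acc ((· < ·) : Υ → Υ → Prop) a := by
    intro a
    induction a using hw.wf.induction with
    | _ a ih => exact ⟨_, fun y hy => ih ⟨y, hy.le.trans a.2⟩ hy⟩
  exact key ⟨t, le_refl t⟩

theorem tree_exists_isLeast {S : Set Υ} {t : Υ} (hS : S.Nonempty) (h : S ⊆ Set.Iic t) :
    ∃ m, IsLeast S m := by
  obtain ⟨m, hm, hmin⟩ := tree_wellFounded.has_min S hS
  refine ⟨m, hm, fun x hx => ?_⟩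
  rcases tree_total (h hm) (h hx) with h1 | h1
  · exact h1
  · rcases h1.lt_or_eq with h2 | h2
    · exact absurd h2 (hmin x hx)
    · exact h2.ge

/-- This is where the Hausdorff axiom enters. The least points of {s ≤ x} outside {s ≤ y}, and of {s
≤ y} outside {s ≤ x}, both have the intersection as their set of strict predecessors. Without a
greatest element they would be limit points, hence equal, which is absurd. -/
theorem tree_exists_isGreatest_inter {x y : Υ} (h : (Set.Iic x ∩ Set.Iic y).Nonempty) :
    ∃ m, IsGreatest (Set.Iic x ∩ Set.Iic y) m := by
  by_contra hno
  have main : ∀ x y : Υ, (¬ ∃ m, IsGreatest (Set.Iic x ∩ Set.Iic y) m) →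
      ∃ a, a ≤ x ∧ ¬ a ≤ y ∧ Set.Iio a = Set.Iic x ∩ Set.Iic y := by
    intro x y hno
    have hxy : ¬ x ≤ y := fun hxy => hno ⟨x, ⟨le_refl _, hxy⟩, fun z hz => hz.1⟩
    obtain ⟨a, ha, hmin⟩ := tree_exists_isLeast (S := {z | z ≤ x ∧ ¬ z ≤ y}) (t := x)
      ⟨x, le_refl x, hxy⟩ (fun z hz => hz.1)
    refine ⟨a, ha.1, ha.2, Set.ext fun z => ⟨fun hz => ?_, fun hz => ?_⟩⟩
    · have hz' : z < a := hz
      refine ⟨hz'.le.trans ha.1, ?_⟩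
      by_contra hzy
      exact absurd (hmin ⟨hz'.le.trans ha.1, hzy⟩) (not_le_of_gt hz')
    · rcases tree_total hz.1 ha.1 with h1 | h1
      · exact lt_of_le_of_ne h1 (fun h => ha.2 (h ▸ hz.2))
      · exact absurd (h1.trans hz.2) ha.2
  obtain ⟨a, hax, hay, ha⟩ := main x y hno
  obtain ⟨b, hby, hbx, hb⟩ := main y x (by rwa [Set.inter_comm])
  have hlim : Order.IsSuccLimit a := by
    refine ⟨?_, ?_⟩
    · intro hmin
      obtain ⟨z, hz⟩ := h
      rw [← ha] at hz
      exact hmin.not_lt hz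
    · intro z hz
      apply hno
      refine ⟨z, by rw [← ha]; exact hz.lt, fun w hw => ?_⟩
      rw [← ha] at hw
      have hw' : w < a := hw
      rcases tree_total hw'.le hz.lt.le with h1 | h1
      · exact h1
      · rcases h1.lt_or_eq with h2 | h2
        · exact absurd hw' (hz.2 h2)
        · exact h2.ge
  have hab : a = b := IsHausdorffTree.eq_of_Iio_eq a b hlim (by rw [ha, hb, Set.inter_comm])
  exact hay (hab ▸ hby)

theorem tree_exists_covBy_le {y x : Υ} (h : y < x) : ∃ u, y ⋖ u ∧ u ≤ x := by
  obtain ⟨u, hu, hmin⟩ := tree_exists_isLeast (S := {z | y < z ∧ z ≤ x}) (t := x)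
    ⟨x, h, le_refl x⟩ (fun z hz => hz.2)
  refine ⟨u, ⟨hu.1, fun c hc hcu => ?_⟩, hu.2⟩
  exact absurd (hmin ⟨hc, hcu.le.trans hu.2⟩) (not_le_of_gt hcu)

theorem tree_covBy_le {y u x z : Υ} (hu : y ⋖ u) (hux : u ≤ x) (hz : y < z) (hzx : z ≤ x) :
    u ≤ z := by
  rcases tree_total hux hzx with h1 | h1
  · exact h1
  · rcases h1.lt_or_eq with h2 | h2
    · exact absurd h2 (hu.2 hz)
    · exact h2.ge

theorem tree_covBy_unique {y u u' x : Υ} (hu : y ⋖ u) (hux : u ≤ x) (hu' : y ⋖ u')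
    (hux' : u' ≤ x) : u = u' :=
  le_antisymm (tree_covBy_le hu hux hu'.lt hux') (tree_covBy_le hu' hux' hu.lt hux)

theorem tree_le_of_lt_covBy {y x s : Υ} (h : y ⋖ x) (hs : s < x) : s ≤ y := by
  rcases tree_total hs.le h.lt.le with h1 | h1
  · exact h1
  · rcases h1.lt_or_eq with h2 | h2
    · exact absurd hs (h.2 h2)
    · exact h2.ge

theorem tree_pred_unique {y y' x : Υ} (h : y ⋖ x) (h' : y' ⋖ x) : y = y' :=
  le_antisymm (tree_le_of_lt_covBy h' h.lt) (tree_le_of_lt_covBy h h'.lt)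

/-- The meets of `x` with elements of `F` lie on the chain below `x`, so one is largest. Thus the
part of {s ≤ x} already covered by `F` is empty or a single {s ≤ m}, as needed for gluing one chain
at a time. -/
theorem tree_exists_max_meet (F : Finset Υ) (x : Υ) :
    (∀ y ∈ F, ∀ s ≤ x, ¬ s ≤ y) ∨
      ∃ y ∈ F, ∃ m, IsGreatest (Set.Iic x ∩ Set.Iic y) m ∧
        ∀ y' ∈ F, ∀ s ≤ x, s ≤ y' → s ≤ m := by
  classical
  induction F using Finset.induction_on with
  | empty => left; simp
  | insert a F _ ih =>
    by_cases ha : (Set.Iic x ∩ Set.Iic a).Nonempty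
    · right
      obtain ⟨m, hm⟩ := tree_exists_isGreatest_inter ha
      rcases ih with ih | ⟨y, hy, m', hm', ih⟩
      · refine ⟨a, by simp, m, hm, fun y' hy' s hs hsy => ?_⟩
        rcases Finset.mem_insert.1 hy' with rfl | hy'
        · exact hm.2 ⟨hs, hsy⟩
        · exact absurd hsy (ih y' hy' s hs)
      · rcases tree_total hm.1.1 hm'.1.1 with h1 | h1
        · refine ⟨y, by simp [hy], m', hm', fun y' hy' s hs hsy => ?_⟩
          rcases Finset.mem_insert.1 hy' with rfl | hy'
          · exact (hm.2 ⟨hs, hsy⟩).trans h1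
          · exact ih y' hy' s hs hsy
        · refine ⟨a, by simp, m, hm, fun y' hy' s hs hsy => ?_⟩
          rcases Finset.mem_insert.1 hy' with rfl | hy'
          · exact hm.2 ⟨hs, hsy⟩
          · exact (ih y' hy' s hs hsy).trans h1
    · rcases ih with ih | ⟨y, hy, m', hm', ih⟩
      · left
        intro y hy s hs hsy
        rcases Finset.mem_insert.1 hy with rfl | hy
        · exact ha ⟨s, hs, hsy⟩
        · exact ih y hy s hs hsy
      · right
        refine ⟨y, by simp [hy], m', hm', fun y' hy' s hs hsy => ?_⟩
        rcases Finset.mem_insert.1 hy' with rfl | hy'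
        · exact absurd ⟨s, hs, hsy⟩ ha
        · exact ih y' hy' s hs hsy

end TreeOrder

/-! ### Neighbourhoods and compact initial segments in the tree topology. -/

section TreeTopology

variable {Υ : Type*} [PartialOrder Υ] [TopologicalSpace Υ] [HasTreeTopology Υ]

theorem tree_isOpen_Iic (t : Υ) : IsOpen (Set.Iic t) := by
  rw [HasTreeTopology.topology_eq (Υ := Υ)]
  exact TopologicalSpace.isOpen_generateFrom_of_mem ⟨t, Or.inl rfl⟩

theorem tree_isClosed_Iic (t : Υ) : IsClosed (Set.Iic t) := by
  rw [← isOpen_compl_iff, HasTreeTopology.topology_eq (Υ := Υ)]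
  exact TopologicalSpace.isOpen_generateFrom_of_mem ⟨t, Or.inr rfl⟩

variable [IsHausdorffTree Υ]

/-- The case that uses the tree is the complement of {s ≤ a}: if `m` is the meet of `t` and `a`,
then (m, t] avoids {s ≤ a}. -/
theorem tree_exists_Ioc_subset {U : Set Υ} (hU : IsOpen U) {t : Υ} (ht : t ∈ U) :
    Set.Iic t ⊆ U ∨ ∃ s < t, Set.Ioc s t ⊆ U := by
  rw [HasTreeTopology.topology_eq (Υ := Υ)] at hU
  change TopologicalSpace.GenerateOpen _ U at hU
  induction hU with
  | basic V hV =>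
    obtain ⟨a, rfl | rfl⟩ := hV
    · left
      exact Set.Iic_subset_Iic.2 ht
    · by_cases hne : (Set.Iic t ∩ Set.Iic a).Nonempty
      · right
        obtain ⟨m, hm⟩ := tree_exists_isGreatest_inter hne
        refine ⟨m, lt_of_le_of_ne hm.1.1 ?_, fun z hz hza => ?_⟩
        · rintro rfl
          exact ht hm.1.2
        · exact absurd (hm.2 ⟨hz.2, hza⟩) (not_le_of_gt hz.1)
      · left
        intro z hz hza
        exact hne ⟨z, hz, hza⟩
  | univ => left; exact Set.subset_univ _
  | inter V W _ _ ih1 ih2 =>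
    rcases ih1 ht.1 with h1 | ⟨s1, hs1, h1⟩
    · rcases ih2 ht.2 with h2 | ⟨s2, hs2, h2⟩
      · exact Or.inl (Set.subset_inter h1 h2)
      · exact Or.inr ⟨s2, hs2, Set.subset_inter (fun z hz => h1 hz.2) h2⟩
    · rcases ih2 ht.2 with h2 | ⟨s2, hs2, h2⟩
      · exact Or.inr ⟨s1, hs1, Set.subset_inter h1 (fun z hz => h2 hz.2)⟩
      · right
        rcases tree_total hs1.le hs2.le with h | h
        · exact ⟨s2, hs2, fun z hz => ⟨h1 ⟨h.trans_lt hz.1, hz.2⟩, h2 hz⟩⟩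
        · exact ⟨s1, hs1, fun z hz => ⟨h1 hz, h2 ⟨h.trans_lt hz.1, hz.2⟩⟩⟩
  | sUnion S _ ih =>
    obtain ⟨V, hV, htV⟩ := ht
    rcases ih V hV htV with h | ⟨s, hs, h⟩
    · exact Or.inl (h.trans (Set.subset_sUnion_of_mem hV))
    · exact Or.inr ⟨s, hs, h.trans (Set.subset_sUnion_of_mem hV)⟩

theorem tree_isCompact_Iic (t : Υ) : IsCompact (Set.Iic t) := by
  classical
  induction t using (tree_wellFounded (Υ := Υ)).induction with
  | _ t ih =>
    refine isCompact_of_finite_subcover fun {ι} U hU hcov => ?_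
    obtain ⟨i, hi⟩ := Set.mem_iUnion.1 (hcov (le_refl t))
    rcases tree_exists_Ioc_subset (hU i) hi with h | ⟨s, hs, h⟩
    · exact ⟨{i}, by simpa using h⟩
    · obtain ⟨F, hF⟩ := (ih s hs).elim_finite_subcover U hU
        ((Set.Iic_subset_Iic.2 hs.le).trans hcov)
      refine ⟨insert i F, fun z hz => ?_⟩
      rcases tree_total (Set.mem_Iic.1 hz) hs.le with h1 | h1
      · obtain ⟨j, hj, hz'⟩ := Set.mem_iUnion₂.1 (hF h1)
        exact Set.mem_iUnion₂.2 ⟨j, Finset.mem_insert_of_mem hj, hz'⟩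
      · rcases h1.lt_or_eq with h2 | h2
        · exact Set.mem_iUnion₂.2 ⟨i, Finset.mem_insert_self _ _, h ⟨h2, hz⟩⟩
        · obtain ⟨j, hj, hz'⟩ := Set.mem_iUnion₂.1 (hF h2.ge)
          exact Set.mem_iUnion₂.2 ⟨j, Finset.mem_insert_of_mem hj, hz'⟩

end TreeTopology

/-! ### Basic estimates in C₀, and finite covers of the sets where |f| is large. -/

section C0

variable {Υ : Type*} [TopologicalSpace Υ]

theorem c0_norm_le {f : C₀(Υ, ℝ)} {C : ℝ} (hC : 0 ≤ C) (h : ∀ s, |f s| ≤ C) : ‖f‖ ≤ C := by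
  rw [← ZeroAtInftyContinuousMap.norm_toBCF_eq_norm]
  exact (BoundedContinuousFunction.norm_le hC).2 h

theorem c0_abs_apply_le (f : C₀(Υ, ℝ)) (s : Υ) : |f s| ≤ ‖f‖ := by
  rw [← ZeroAtInftyContinuousMap.norm_toBCF_eq_norm]
  exact f.toBCF.norm_coe_le_norm s

theorem c0_isCompact_le_abs (f : C₀(Υ, ℝ)) {ε : ℝ} (hε : 0 < ε) : IsCompact {s | ε ≤ |f s|} := by
  have h := f.zero_at_infty' (Metric.ball_mem_nhds 0 hε)
  obtain ⟨K, hK, hsub⟩ := mem_cocompact.1 h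
  refine hK.of_isClosed_subset (isClosed_le continuous_const f.continuous.abs) fun s hs => ?_
  by_contra hsK
  have := hsub hsK
  simp only [Set.mem_preimage, Metric.mem_ball, dist_zero_right, Real.norm_eq_abs] at this
  exact absurd (show ε ≤ |f s| from hs) (not_le_of_gt this)

/-- Evaluation at a point, as a linear functional on `C₀`. -/
noncomputable def c0Eval (t : Υ) : C₀(Υ, ℝ) →ₗ[ℝ] ℝ where
  toFun f := f t
  map_add' _ _ := rfl
  map_smul' _ _ := rfl

@[simp] theorem c0Eval_apply (t : Υ) (f : C₀(Υ, ℝ)) : c0Eval t f = f t := rfl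

theorem tree_finite_cover [PartialOrder Υ] [HasTreeTopology Υ] (f : C₀(Υ, ℝ)) {S : Set Υ} (hS : ∀ s, f s ≠ 0 → ∃ x ∈ S, s ≤ x) {ε : ℝ}
    (hε : 0 < ε) : ∃ F : Finset Υ, (∀ x ∈ F, x ∈ S) ∧ ∀ s, ε ≤ |f s| → ∃ x ∈ F, s ≤ x := by
  classical
  obtain ⟨F, hF⟩ := (c0_isCompact_le_abs f hε).elim_finite_subcover (fun x : S => Set.Iic (x : Υ))
    (fun x => tree_isOpen_Iic _) (fun s hs => by
      have hs' : ε ≤ |f s| := hs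
      obtain ⟨x, hx, hsx⟩ := hS s (fun h => by rw [h, abs_zero] at hs'; linarith)
      exact Set.mem_iUnion.2 ⟨⟨x, hx⟩, hsx⟩)
  refine ⟨F.image Subtype.val, fun x hx => ?_, fun s hs => ?_⟩
  · obtain ⟨y, -, rfl⟩ := Finset.mem_image.1 hx
    exact y.2
  · obtain ⟨x, hx, hsx⟩ := Set.mem_iUnion₂.1 (hF hs)
    exact ⟨x, Finset.mem_image_of_mem _ hx, hsx⟩

end C0

/-! ### Indicators of initial segments and the closed subspaces they generate. -/

section Chi

variable {Υ : Type*} [PartialOrder Υ] [IsHausdorffTree Υ] [TopologicalSpace Υ] [HasTreeTopology Υ]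

/-- The indicator function of the compact open set `{s | s ≤ t}`. -/
noncomputable def treeChi (t : Υ) : C₀(Υ, ℝ) where
  toFun := Set.indicator (Set.Iic t) 1
  continuous_toFun :=
    IsClopen.continuous_indicator ⟨tree_isClosed_Iic t, tree_isOpen_Iic t⟩ continuous_one
  zero_at_infty' := by
    refine tendsto_const_nhds.congr' ?_
    filter_upwards [(tree_isCompact_Iic t).compl_mem_cocompact] with s hs
    exact (Set.indicator_of_notMem hs _).symm

theorem treeChi_of_le {s t : Υ} (h : s ≤ t) : treeChi t s = 1 :=
  Set.indicator_of_mem (Set.mem_Iic.2 h) _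

theorem treeChi_of_not_le {s t : Υ} (h : ¬ s ≤ t) : treeChi t s = 0 :=
  Set.indicator_of_notMem (by exact h) _

theorem mem_of_forall_norm_sub_le {X : Type*} [NormedAddCommGroup X] [NormedSpace ℝ X]
    {Y : Submodule ℝ X} (hY : IsClosed (Y : Set X)) {x : X}
    (h : ∀ ε > 0, ∃ y ∈ Y, ‖x - y‖ ≤ ε) : x ∈ Y := by
  have : x ∈ closure (Y : Set X) := by
    refine Metric.mem_closure_iff.2 fun ε hε => ?_
    obtain ⟨y, hy, hxy⟩ := h (ε / 2) (by positivity)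
    exact ⟨y, hy, by rw [dist_eq_norm]; linarith⟩
  rwa [hY.closure_eq] at this

/-- If `f` is locally constant, along the chain below `x`, at every point `y` whose indicator
function is not in `Y`, then the variation of `f` on that chain is in `Y`. -/
theorem mul_treeChi_sub_mem {Y : Submodule ℝ C₀(Υ, ℝ)} (hY : IsClosed (Y : Set C₀(Υ, ℝ)))
    (f : C₀(Υ, ℝ)) (x : Υ)
    (h : ∀ y < x, ∀ y', y ⋖ y' → y' ≤ x → f y = f y' ∨ treeChi y ∈ Y) :
    f * treeChi x - f x • treeChi x ∈ Y := by
  induction x using (tree_wellFounded (Υ := Υ)).induction with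
  | _ x ih =>
    by_cases hsucc : ∃ y, y ⋖ x
    · obtain ⟨y, hy⟩ := hsucc
      have h1 := ih y hy.lt fun z hz z' hzz' hz' => h z (hz.trans hy.lt) z' hzz' (hz'.trans hy.lt.le)
      -- At a successor `x` of `y`, passing from `y` to `x` changes the variation by a multiple of
      -- χ_y only.
      have heq : f * treeChi x - f x • treeChi x =
          (f * treeChi y - f y • treeChi y) + (f y - f x) • treeChi y := by
        ext s
        simp only [ZeroAtInftyContinuousMap.sub_apply, ZeroAtInftyContinuousMap.mul_apply,
          ZeroAtInftyContinuousMap.smul_apply, ZeroAtInftyContinuousMap.add_apply, smul_eq_mul]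
        by_cases hsy : s ≤ y
        · rw [treeChi_of_le hsy, treeChi_of_le (hsy.trans hy.lt.le)]; ring
        · rw [treeChi_of_not_le hsy]
          by_cases hsx : s ≤ x
          · rcases hsx.lt_or_eq with h2 | rfl
            · exact absurd (tree_le_of_lt_covBy hy h2) hsy
            · ring
          · rw [treeChi_of_not_le hsx]; ring
      rw [heq]
      refine Y.add_mem h1 ?_
      rcases h y hy.lt x hy le_rfl with h2 | h2
      · rw [h2, sub_self, zero_smul]; exact Y.zero_mem
      · exact Y.smul_mem _ h2
    · refine mem_of_forall_norm_sub_le hY fun ε hε => ?_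
      -- At a limit point continuity keeps `f` within `ε` of `f x` on some (s₀, x], so the variation
      -- up to any `y` in that interval is an `ε`-approximation.
      have hopen : IsOpen {s | |f s - f x| < ε} :=
        isOpen_lt ((f.continuous.sub continuous_const).abs) continuous_const
      rcases tree_exists_Ioc_subset hopen (t := x) (by simpa using hε) with h1 | ⟨s₀, hs₀, h1⟩
      · refine ⟨0, Y.zero_mem, c0_norm_le hε.le fun s => ?_⟩
        simp only [sub_zero, ZeroAtInftyContinuousMap.sub_apply, ZeroAtInftyContinuousMap.mul_apply,
          ZeroAtInftyContinuousMap.smul_apply, smul_eq_mul]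
        by_cases hsx : s ≤ x
        · rw [treeChi_of_le hsx, mul_one, mul_one]
          exact le_of_lt (h1 hsx)
        · rw [treeChi_of_not_le hsx]; simpa using hε.le
      · obtain ⟨y, hsy, hyx⟩ : ∃ y, s₀ < y ∧ y < x := by
          by_contra hno
          push Not at hno
          exact hsucc ⟨s₀, hs₀, fun c hc hcx => hno c hc hcx⟩
        refine ⟨_, ih y hyx fun z hz z' hzz' hz' => h z (hz.trans hyx) z' hzz' (hz'.trans hyx.le),
          c0_norm_le hε.le fun s => ?_⟩
        simp only [ZeroAtInftyContinuousMap.sub_apply, ZeroAtInftyContinuousMap.mul_apply,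
          ZeroAtInftyContinuousMap.smul_apply, smul_eq_mul]
        by_cases hsx : s ≤ x
        · rw [treeChi_of_le hsx]
          rcases tree_total hsx hyx.le with h2 | h2
          · rw [treeChi_of_le h2]
            have : |f y - f x| < ε := h1 ⟨hsy, hyx.le⟩
            rw [show f s * 1 - f x * 1 - (f s * 1 - f y * 1) = f y - f x by ring]
            exact this.le
          · rcases h2.lt_or_eq with h3 | rfl
            · rw [treeChi_of_not_le h3.not_ge]
              have : |f s - f x| < ε := h1 ⟨hsy.trans h3, hsx⟩
              rw [show f s * 1 - f x * 1 - (f s * 0 - f y * 0) = f s - f x by ring]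
              exact this.le
            · rw [treeChi_of_le le_rfl]
              have : |f y - f x| < ε := h1 ⟨hsy, hyx.le⟩
              rw [show f y * 1 - f x * 1 - (f y * 1 - f y * 1) = f y - f x by ring]
              exact this.le
        · rw [treeChi_of_not_le hsx, treeChi_of_not_le (fun h => hsx (h.trans hyx.le))]
          simpa using hε.le

/-- At a meet `m`, `f * treeChi m` is the variation of `f` below `m` plus a multiple of χ_m, hence
lies in `Y`. Restrictions of `f` to finite unions of chains {s ≤ x} are obtained from these products
by inclusion-exclusion, and they approximate `f` because the sets {|f| ≥ ε} are covered by finitely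
many such chains. -/
theorem mem_of_forall_treeChi_meet_mem {Y : Submodule ℝ C₀(Υ, ℝ)}
    (hY : IsClosed (Y : Set C₀(Υ, ℝ))) (f : C₀(Υ, ℝ)) {S : Set Υ}
    (hS : ∀ s, f s ≠ 0 → ∃ x ∈ S, s ≤ x)
    (hM : ∀ x ∈ S, ∀ y ∈ S, ∀ m, IsGreatest (Set.Iic x ∩ Set.Iic y) m → treeChi m ∈ Y)
    (hstep : ∀ x ∈ S, ∀ y < x, ∀ y', y ⋖ y' → y' ≤ x → f y = f y' ∨ treeChi y ∈ Y) :
    f ∈ Y := by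
  classical
  have hmul : ∀ x ∈ S, ∀ y ∈ S, ∀ m, IsGreatest (Set.Iic x ∩ Set.Iic y) m →
      f * treeChi m ∈ Y := by
    intro x hx y hy m hm
    have h1 := mul_treeChi_sub_mem hY f m fun z hz z' hzz' hz' =>
      hstep x hx z (hz.trans_le hm.1.1) z' hzz' (hz'.trans hm.1.1)
    have h2 := Y.add_mem h1 (Y.smul_mem (f m) (hM x hx y hy m hm))
    rwa [sub_add_cancel] at h2
  have hfin : ∀ F : Finset Υ, (∀ x ∈ F, x ∈ S) →
      ∃ g ∈ Y, ∀ s, ((∃ x ∈ F, s ≤ x) → g s = f s) ∧ ((¬ ∃ x ∈ F, s ≤ x) → g s = 0) := by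
    intro F
    induction F using Finset.induction_on with
    | empty => exact fun _ => ⟨0, Y.zero_mem, by simp⟩
    | insert x F _ ih =>
      intro hF
      obtain ⟨g, hgY, hg⟩ := ih fun z hz => hF z (Finset.mem_insert_of_mem hz)
      have hx : x ∈ S := hF x (Finset.mem_insert_self _ _)
      have hfx : f * treeChi x ∈ Y := hmul x hx x hx x ⟨⟨le_rfl, le_rfl⟩, fun z hz => hz.1⟩
      rcases tree_exists_max_meet F x with hd | ⟨y, hy, m, hm, hd⟩
      · refine ⟨g + f * treeChi x, Y.add_mem hgY hfx, fun s => ⟨?_, ?_⟩⟩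
        · rintro ⟨z, hz, hsz⟩
          simp only [ZeroAtInftyContinuousMap.add_apply, ZeroAtInftyContinuousMap.mul_apply]
          by_cases hsx : s ≤ x
          · rw [treeChi_of_le hsx, (hg s).2 fun ⟨w, hw, hsw⟩ => hd w hw s hsx hsw]; ring
          · rw [treeChi_of_not_le hsx, (hg s).1]
            · ring
            · rcases Finset.mem_insert.1 hz with rfl | hz
              · exact absurd hsz hsx
              · exact ⟨z, hz, hsz⟩
        · intro hno
          simp only [ZeroAtInftyContinuousMap.add_apply, ZeroAtInftyContinuousMap.mul_apply]
          rw [treeChi_of_not_le fun hsx => hno ⟨x, Finset.mem_insert_self _ _, hsx⟩,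
            (hg s).2 fun ⟨w, hw, hsw⟩ => hno ⟨w, Finset.mem_insert_of_mem hw, hsw⟩]
          ring
      · have hfm := hmul x hx y (hF y (Finset.mem_insert_of_mem hy)) m hm
        -- The chain below `x` meets the part already treated exactly in {s ≤ m}, so only the piece
        -- over {s ≤ x} minus {s ≤ m} is added.
        refine ⟨g + (f * treeChi x - f * treeChi m), Y.add_mem hgY (Y.sub_mem hfx hfm),
          fun s => ⟨?_, ?_⟩⟩
        · rintro ⟨z, hz, hsz⟩
          simp only [ZeroAtInftyContinuousMap.add_apply, ZeroAtInftyContinuousMap.sub_apply,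
            ZeroAtInftyContinuousMap.mul_apply]
          by_cases hsx : s ≤ x
          · rw [treeChi_of_le hsx]
            by_cases hsF : ∃ w ∈ F, s ≤ w
            · obtain ⟨w, hw, hsw⟩ := hsF
              rw [(hg s).1 ⟨w, hw, hsw⟩, treeChi_of_le (hd w hw s hsx hsw)]; ring
            · rw [(hg s).2 hsF, treeChi_of_not_le fun h => hsF ⟨y, hy, h.trans hm.1.2⟩]; ring
          · rw [treeChi_of_not_le hsx, treeChi_of_not_le fun h => hsx (h.trans hm.1.1), (hg s).1]
            · ring
            · rcases Finset.mem_insert.1 hz with rfl | hz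
              · exact absurd hsz hsx
              · exact ⟨z, hz, hsz⟩
        · intro hno
          have hsx : ¬ s ≤ x := fun hsx => hno ⟨x, Finset.mem_insert_self _ _, hsx⟩
          simp only [ZeroAtInftyContinuousMap.add_apply, ZeroAtInftyContinuousMap.sub_apply,
            ZeroAtInftyContinuousMap.mul_apply]
          rw [treeChi_of_not_le hsx, treeChi_of_not_le fun h => hsx (h.trans hm.1.1),
            (hg s).2 fun ⟨w, hw, hsw⟩ => hno ⟨w, Finset.mem_insert_of_mem hw, hsw⟩]
          ring
  refine mem_of_forall_norm_sub_le hY fun ε hε => ?_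
  obtain ⟨F, hFS, hF⟩ := tree_finite_cover f hS hε
  obtain ⟨g, hgY, hg⟩ := hfin F hFS
  refine ⟨g, hgY, c0_norm_le hε.le fun s => ?_⟩
  rw [ZeroAtInftyContinuousMap.sub_apply]
  by_cases hs : ∃ x ∈ F, s ≤ x
  · rw [(hg s).1 hs, sub_self, abs_zero]; exact hε.le
  · rw [(hg s).2 hs, sub_zero]
    by_contra hlt
    exact hs (hF s (not_le.1 hlt).le)

theorem mem_of_forall_treeChi_mem {Y : Submodule ℝ C₀(Υ, ℝ)}
    (hY : IsClosed (Y : Set C₀(Υ, ℝ))) (h : ∀ t, treeChi t ∈ Y) (f : C₀(Υ, ℝ)) : f ∈ Y :=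
  mem_of_forall_treeChi_meet_mem hY f (S := Set.univ) (fun s _ => ⟨s, trivial, le_rfl⟩)
    (fun _ _ _ _ m _ => h m) (fun _ _ y _ _ _ _ => Or.inr (h y))

theorem exists_mem_span_treeChi_norm_sub_lt (f : C₀(Υ, ℝ)) {ε : ℝ} (hε : 0 < ε) :
    ∃ h ∈ Submodule.span ℝ (Set.range (treeChi (Υ := Υ))), ‖f - h‖ < ε := by
  have hf := mem_of_forall_treeChi_mem
    (Y := (Submodule.span ℝ (Set.range (treeChi (Υ := Υ)))).topologicalClosure)
    (Submodule.isClosed_topologicalClosure _)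
    (fun t => Submodule.le_topologicalClosure _ (Submodule.subset_span ⟨t, rfl⟩)) f
  obtain ⟨h, hh, hd⟩ := Metric.mem_closure_iff.1
    (show f ∈ closure ((Submodule.span ℝ (Set.range (treeChi (Υ := Υ))) : Submodule ℝ _) :
      Set C₀(Υ, ℝ)) from hf) ε hε
  exact ⟨h, hh, by rwa [dist_eq_norm] at hd⟩

end Chi

/-! ### Convexity defects and ℓ²-sums of seminorms. -/

section Defect

variable {X : Type*} [NormedAddCommGroup X] [NormedSpace ℝ X]

/-- The quantity `2 p(x)² + 2 p(y)² - p(x + y)²`, which measures how far the midpoint of `x` and `y`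
is from being `p`-extremal. -/
def convexityDefect (p : Seminorm ℝ X) (x y : X) : ℝ := 2 * p x ^ 2 + 2 * p y ^ 2 - p (x + y) ^ 2

theorem sq_sub_le_convexityDefect (p : Seminorm ℝ X) (x y : X) :
    (p x - p y) ^ 2 ≤ convexityDefect p x y := by
  have h1 := map_add_le_add p x y
  have h2 : p (x + y) ^ 2 ≤ (p x + p y) ^ 2 := pow_le_pow_left₀ (apply_nonneg p _) h1 2
  unfold convexityDefect
  linarith [show 2 * p x ^ 2 + 2 * p y ^ 2 - (p x + p y) ^ 2 = (p x - p y) ^ 2 by ring]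

theorem convexityDefect_nonneg (p : Seminorm ℝ X) (x y : X) : 0 ≤ convexityDefect p x y :=
  (sq_nonneg _).trans (sq_sub_le_convexityDefect p x y)

theorem convexityDefect_smul (c : NNReal) (p : Seminorm ℝ X) (x y : X) :
    convexityDefect (c • p) x y = (c : ℝ) ^ 2 * convexityDefect p x y := by
  simp only [convexityDefect, smul_apply, NNReal.smul_def, smul_eq_mul]
  ring

/-- The square root of the sum of the squares of a family of seminorms. -/
noncomputable def l2Seminorm {ι : Type*} (p : ι → Seminorm ℝ X)
    (hp : ∀ x, Summable fun i => p i x ^ 2) : Seminorm ℝ X :=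
  Seminorm.of (fun x => √(∑' i, p i x ^ 2))
    (by
      intro x y
      have h := Real.Lp_add_le_tsum_of_nonneg (p := 2) one_le_two (f := fun i => p i x)
        (g := fun i => p i y) (fun i => apply_nonneg _ _) (fun i => apply_nonneg _ _)
        (by simpa using hp x) (by simpa using hp y)
      simp only [Real.rpow_two, ← Real.sqrt_eq_rpow] at h
      refine le_trans (Real.sqrt_le_sqrt ?_) h.2
      exact (hp (x + y)).tsum_le_tsum
        (fun i => pow_le_pow_left₀ (apply_nonneg _ _) (map_add_le_add (p i) x y) 2) h.1)
    (by
      intro a x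
      simp only [map_smul_eq_mul, mul_pow]
      rw [tsum_mul_left, Real.sqrt_mul (by positivity), Real.sqrt_sq (norm_nonneg a)])

variable {ι : Type*} (p : ι → Seminorm ℝ X) (hp : ∀ x, Summable fun i => p i x ^ 2)

theorem l2Seminorm_sq (x : X) : l2Seminorm p hp x ^ 2 = ∑' i, p i x ^ 2 :=
  Real.sq_sqrt (tsum_nonneg fun _ => sq_nonneg _)

/-- The defect is linear in the squared seminorm, so the defect of an ℓ²-sum is the sum of the
nonnegative defects. -/
theorem convexityDefect_le_l2Seminorm (i : ι) (x y : X) :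
    convexityDefect (p i) x y ≤ convexityDefect (l2Seminorm p hp) x y := by
  have h : HasSum (fun i => convexityDefect (p i) x y) (convexityDefect (l2Seminorm p hp) x y) := by
    unfold convexityDefect
    rw [l2Seminorm_sq, l2Seminorm_sq, l2Seminorm_sq]
    exact (((hp x).hasSum.mul_left 2).add ((hp y).hasSum.mul_left 2)).sub (hp (x + y)).hasSum
  exact le_hasSum h i fun j _ => convexityDefect_nonneg _ _ _

/-- The seminorm `(p² + q²)^(1/2)`. -/
noncomputable def hypotSeminorm (p q : Seminorm ℝ X) : Seminorm ℝ X :=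
  l2Seminorm (fun b : Bool => cond b p q) fun _ => Summable.of_finite

theorem hypotSeminorm_sq (p q : Seminorm ℝ X) (x : X) :
    hypotSeminorm p q x ^ 2 = p x ^ 2 + q x ^ 2 := by
  rw [hypotSeminorm, l2Seminorm_sq, tsum_bool, add_comm]
  rfl

theorem convexityDefect_le_hypotSeminorm_right (p q : Seminorm ℝ X) (x y : X) :
    convexityDefect q x y ≤ convexityDefect (hypotSeminorm p q) x y :=
  convexityDefect_le_l2Seminorm (fun b : Bool => cond b p q) (fun _ => Summable.of_finite) false x y

/-- One norm controls countably many seminorms at once: if its defect tends to 0, so do all of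
theirs. -/
theorem exists_isEquivalentNorm_dominating [Encodable ι] (C : ι → ℝ)
    (hC : ∀ i x, p i x ≤ C i * ‖x‖) :
    ∃ N : Seminorm ℝ X, IsEquivalentNorm N ∧
      ∀ i, ∃ c > 0, ∀ x y, c * convexityDefect (p i) x y ≤ convexityDefect N x y := by
  -- The weights bound the square of the `i`-th term by a geometric sequence times ‖x‖²; `toNNReal`
  -- keeps the denominator positive even if `C i` is negative.
  let w : ι → NNReal := fun i => (1 / 2) ^ Encodable.encode i / (1 + Real.toNNReal (C i))
  have hw0 : ∀ i, 0 < w i := fun i => by positivity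
  have hwp : ∀ i x, (w i • p i) x ^ 2 ≤ (1 / 2 : ℝ) ^ Encodable.encode i * ‖x‖ ^ 2 := by
    intro i x
    have h1 : (1 / 2 : ℝ) ^ Encodable.encode i ≤ 1 := pow_le_one₀ (by norm_num) (by norm_num)
    have h0 : (0 : ℝ) < (1 / 2 : ℝ) ^ Encodable.encode i := by positivity
    have h2 : (w i • p i) x ≤ (1 / 2 : ℝ) ^ Encodable.encode i * ‖x‖ := by
      rw [smul_apply, NNReal.smul_def, smul_eq_mul]
      have hD : (0 : ℝ) < 1 + max (C i) 0 := by positivity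
      have h3 : p i x ≤ (1 + max (C i) 0) * ‖x‖ := (hC i x).trans
        (mul_le_mul_of_nonneg_right (by linarith [le_max_left (C i) 0]) (norm_nonneg _))
      have h4 : ((w i : NNReal) : ℝ) = (1 / 2 : ℝ) ^ Encodable.encode i / (1 + max (C i) 0) := by
        simp [w, Real.coe_toNNReal']
      rw [h4, div_mul_eq_mul_div, div_le_iff₀ hD, mul_assoc]
      refine mul_le_mul_of_nonneg_left (h3.trans_eq (mul_comm _ _)) h0.le
    calc (w i • p i) x ^ 2 ≤ ((1 / 2 : ℝ) ^ Encodable.encode i * ‖x‖) ^ 2 :=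
          pow_le_pow_left₀ (apply_nonneg _ _) h2 2
      _ = (1 / 2 : ℝ) ^ Encodable.encode i * ((1 / 2 : ℝ) ^ Encodable.encode i * ‖x‖ ^ 2) := by ring
      _ ≤ (1 / 2 : ℝ) ^ Encodable.encode i * (1 * ‖x‖ ^ 2) := by gcongr
      _ = _ := by ring
  have hs2 : Summable fun i : ι => (1 / 2 : ℝ) ^ Encodable.encode i := summable_geometric_two_encode
  have hsum : ∀ x, Summable fun i => (w i • p i) x ^ 2 := fun x =>
    Summable.of_nonneg_of_le (fun i => sq_nonneg _) (fun i => hwp i x) (hs2.mul_right _)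
  refine ⟨hypotSeminorm (normSeminorm ℝ X) (l2Seminorm (fun i => w i • p i) hsum), ?_, ?_⟩
  · set S : ℝ := ∑' i : ι, (1 / 2 : ℝ) ^ Encodable.encode i
    have hS : 0 ≤ S := tsum_nonneg fun _ => by positivity
    refine ⟨1, 1 + S, one_pos, by positivity, fun x => ⟨?_, ?_⟩⟩
    · refine le_of_sq_le_sq ?_ (apply_nonneg _ _)
      rw [hypotSeminorm_sq, one_mul, coe_normSeminorm]
      exact le_add_of_nonneg_right (sq_nonneg _)
    · refine le_of_sq_le_sq ?_ (by positivity)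
      rw [hypotSeminorm_sq, l2Seminorm_sq, coe_normSeminorm]
      have h1 : ∑' i, (w i • p i) x ^ 2 ≤ S * ‖x‖ ^ 2 := by
        rw [← tsum_mul_right]
        exact (hsum x).tsum_le_tsum (fun i => hwp i x) (hs2.mul_right _)
      nlinarith [mul_nonneg hS (sq_nonneg ‖x‖), mul_nonneg (mul_nonneg hS hS) (sq_nonneg ‖x‖)]
  · intro i
    refine ⟨(w i : ℝ) ^ 2, pow_pos (NNReal.coe_pos.2 (hw0 i)) 2, fun x y => ?_⟩
    rw [← convexityDefect_smul]
    exact (convexityDefect_le_l2Seminorm (fun i => w i • p i) hsum i x y).trans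
      (convexityDefect_le_hypotSeminorm_right _ _ x y)

end Defect

/-! ### Distances to subspaces and norming functionals in finite dimension. -/

section DistSeminorm

variable {X : Type*} [NormedAddCommGroup X] [NormedSpace ℝ X]

/-- The distance to a subspace. -/
noncomputable def distSeminorm (V : Submodule ℝ X) : Seminorm ℝ X :=
  (normSeminorm ℝ (X ⧸ V)).comp V.mkQ

theorem distSeminorm_le_norm (V : Submodule ℝ X) (x : X) : distSeminorm V x ≤ ‖x‖ :=
  Submodule.Quotient.norm_mk_le V x

theorem distSeminorm_le_norm_sub {V : Submodule ℝ X} {h : X} (hh : h ∈ V) (x : X) :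
    distSeminorm V x ≤ ‖x - h‖ := by
  have h1 : V.mkQ x = V.mkQ (x - h) := by
    rw [map_sub, show V.mkQ h = 0 from (Submodule.Quotient.mk_eq_zero V).2 hh, sub_zero]
  change ‖V.mkQ x‖ ≤ _
  rw [h1]
  exact Submodule.Quotient.norm_mk_le V (x - h)

theorem exists_norm_sub_lt_of_distSeminorm_lt {V : Submodule ℝ X} {x : X} {ε : ℝ}
    (h : distSeminorm V x < ε) : ∃ v ∈ V, ‖x - v‖ < ε := by
  obtain ⟨m, hm, hlt⟩ := Submodule.Quotient.norm_mk_lt (V.mkQ x) (sub_pos.2 h)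
  refine ⟨x - m, ?_, ?_⟩
  · rw [← Submodule.Quotient.mk_eq_zero, Submodule.Quotient.mk_sub, hm]
    exact sub_self _
  · rw [sub_sub_cancel]
    have h2 : ‖V.mkQ x‖ + (ε - distSeminorm V x) = ε := by
      change distSeminorm V x + _ = _
      ring
    rwa [h2] at hlt

/-- Norming functionals at finitely many points suffice, by compactness of the unit sphere of `V`;
the factor 2 comes from the threshold 1/2 in the cover. -/
theorem exists_finset_norming (V : Submodule ℝ X) [FiniteDimensional ℝ V] :
    ∃ s : Finset (StrongDual ℝ X), (∀ ξ ∈ s, ‖ξ‖ ≤ 1) ∧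
      ∀ h ∈ V, h ≠ 0 → ∃ ξ ∈ s, ‖h‖ ≤ 2 * |ξ h| := by
  classical
  have hK : IsCompact (((↑) : V → X) '' Metric.sphere (0 : V) 1) :=
    (isCompact_sphere (0 : V) 1).image continuous_subtype_val
  choose g hg1 hg2 using fun x : X => exists_dual_vector'' ℝ x
  obtain ⟨F, hF⟩ := hK.elim_finite_subcover (fun x : X => {z | 1 / 2 < g x z})
    (fun x => isOpen_lt continuous_const (g x).continuous) (by
      rintro _ ⟨v, hv, rfl⟩
      refine Set.mem_iUnion.2 ⟨(v : X), ?_⟩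
      have hv1 : ‖(v : X)‖ = 1 := by simpa using hv
      change 1 / 2 < g v v
      rw [hg2, hv1]
      norm_num)
  refine ⟨F.image g, fun ξ hξ => ?_, fun h hh h0 => ?_⟩
  · obtain ⟨x, -, rfl⟩ := Finset.mem_image.1 hξ
    exact hg1 x
  · have hn : 0 < ‖h‖ := norm_pos_iff.2 h0
    have hmem : ‖h‖⁻¹ • h ∈ (((↑) : V → X) '' Metric.sphere (0 : V) 1) := by
      refine ⟨⟨‖h‖⁻¹ • h, V.smul_mem _ hh⟩, ?_, rfl⟩
      rw [mem_sphere_zero_iff_norm, Submodule.coe_norm, norm_smul, norm_inv, norm_norm,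
        inv_mul_cancel₀ hn.ne']
    obtain ⟨x, hx, hlt⟩ := Set.mem_iUnion₂.1 (hF hmem)
    refine ⟨g x, Finset.mem_image_of_mem _ hx, ?_⟩
    have hlt' : 1 / 2 < g x (‖h‖⁻¹ • h) := hlt
    rw [map_smul, smul_eq_mul, inv_mul_eq_div, lt_div_iff₀ hn] at hlt'
    linarith [le_abs_self (g x h)]

end DistSeminorm

/-! ### Suprema over finite index sets, and the selection of the dominant set. -/

section FinsetSup

variable {X : Type*} [NormedAddCommGroup X] [NormedSpace ℝ X] {Γ : Type*}
  (T : Γ → X →ₗ[ℝ] ℝ) (ψ : Finset Γ → Seminorm ℝ X)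

/-- The seminorm `x ↦ ∑ γ ∈ G, |T γ x|`. -/
noncomputable def sumAbsSeminorm (G : Finset Γ) : Seminorm ℝ X :=
  ∑ γ ∈ G, (normSeminorm ℝ ℝ).comp (T γ)

theorem sumAbsSeminorm_apply (G : Finset Γ) (x : X) : sumAbsSeminorm T G x = ∑ γ ∈ G, |T γ x| := by
  classical
  unfold sumAbsSeminorm
  induction G using Finset.induction_on with
  | empty => simp
  | insert a s ha ih => rw [Finset.sum_insert ha, Finset.sum_insert ha, add_apply, ih]; rfl

/-- The seminorm `((∑ γ ∈ G, |T γ x|)² + (ψ G x / (k + 1))²)^(1/2)`. -/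
noncomputable def finsetSeminorm (k : ℕ) (G : Finset Γ) : Seminorm ℝ X :=
  hypotSeminorm (sumAbsSeminorm T G) ((1 / ((k : NNReal) + 1)) • ψ G)

/-- The supremum of `finsetSeminorm T ψ k G` over the sets `G` of cardinality `m`. -/
noncomputable def supFinsetSeminorm (m k : ℕ) : Seminorm ℝ X :=
  ⨆ G : {G : Finset Γ // G.card = m}, finsetSeminorm T ψ k G

variable {T ψ}

theorem finsetSeminorm_sq (k : ℕ) (G : Finset Γ) (x : X) :
    finsetSeminorm T ψ k G x ^ 2 =
      (∑ γ ∈ G, |T γ x|) ^ 2 + (1 / ((k : ℝ) + 1)) ^ 2 * ψ G x ^ 2 := by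
  rw [finsetSeminorm, hypotSeminorm_sq, sumAbsSeminorm_apply, smul_apply, NNReal.smul_def,
    smul_eq_mul, mul_pow]
  simp

theorem one_div_add_one_sq_le (k : ℕ) : (1 / ((k : ℝ) + 1)) ^ 2 ≤ 1 :=
  pow_le_one₀ (by positivity) (by rw [div_le_one (by positivity)]; linarith [k.cast_nonneg (α := ℝ)])

variable (hT : ∀ γ x, |T γ x| ≤ ‖x‖) (hψ : ∀ G x, ψ G x ≤ ‖x‖)
include hT hψ

theorem finsetSeminorm_le {m : ℕ} (k : ℕ) {G : Finset Γ} (hG : G.card = m) (x : X) :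
    finsetSeminorm T ψ k G x ≤ ((m : ℝ) + 1) * ‖x‖ := by
  refine le_of_sq_le_sq ?_ (by positivity)
  rw [finsetSeminorm_sq]
  have h1 : ∑ γ ∈ G, |T γ x| ≤ m * ‖x‖ := by
    refine (Finset.sum_le_card_nsmul G _ ‖x‖ fun γ _ => hT γ x).trans_eq ?_
    rw [hG, nsmul_eq_mul]
  have h2 : (∑ γ ∈ G, |T γ x|) ^ 2 ≤ (m * ‖x‖) ^ 2 :=
    pow_le_pow_left₀ (Finset.sum_nonneg fun _ _ => abs_nonneg _) h1 2
  have h3 : ψ G x ^ 2 ≤ ‖x‖ ^ 2 := pow_le_pow_left₀ (apply_nonneg _ _) (hψ G x) 2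
  have h4 : (1 / ((k : ℝ) + 1)) ^ 2 * ψ G x ^ 2 ≤ 1 * ‖x‖ ^ 2 :=
    mul_le_mul (one_div_add_one_sq_le k) h3 (sq_nonneg _) zero_le_one
  nlinarith [mul_nonneg (m.cast_nonneg (α := ℝ)) (sq_nonneg ‖x‖)]

theorem bddAbove_finsetSeminorm (m k : ℕ) :
    BddAbove (Set.range fun G : {G : Finset Γ // G.card = m} => finsetSeminorm T ψ k G.1) := by
  refine ⟨((m : NNReal) + 1) • normSeminorm ℝ X, ?_⟩
  rintro _ ⟨G, rfl⟩ x
  refine (finsetSeminorm_le hT hψ k G.2 x).trans_eq ?_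
  rw [smul_apply, NNReal.smul_def, smul_eq_mul, coe_normSeminorm]
  simp

theorem supFinsetSeminorm_apply (m k : ℕ) (x : X) :
    supFinsetSeminorm T ψ m k x =
      ⨆ G : {G : Finset Γ // G.card = m}, finsetSeminorm T ψ k G.1 x :=
  Seminorm.iSup_apply (bddAbove_finsetSeminorm hT hψ m k)

theorem finsetSeminorm_le_sup {m : ℕ} (k : ℕ) {G : Finset Γ} (hG : G.card = m) (x : X) :
    finsetSeminorm T ψ k G x ≤ supFinsetSeminorm T ψ m k x := by
  rw [supFinsetSeminorm_apply hT hψ]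
  refine le_ciSup (f := fun G : {G : Finset Γ // G.card = m} => finsetSeminorm T ψ k G.1 x) ?_
    ⟨G, hG⟩
  refine ⟨((m : ℝ) + 1) * ‖x‖, ?_⟩
  rintro _ ⟨G', rfl⟩
  exact finsetSeminorm_le hT hψ k G'.2 x

theorem supFinsetSeminorm_le (m k : ℕ) (x : X) :
    supFinsetSeminorm T ψ m k x ≤ ((m : ℝ) + 1) * ‖x‖ := by
  rw [supFinsetSeminorm_apply hT hψ]
  -- If `Γ` has fewer than `m` elements, the supremum is over an empty family and equals 0, whence
  -- the nonnegativity condition.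
  exact Real.iSup_le (fun G => finsetSeminorm_le hT hψ k G.2 x) (by positivity)

theorem exists_sq_lt_finsetSeminorm_sq {m : ℕ} (k : ℕ) (hne : ∃ G : Finset Γ, G.card = m) (x : X)
    {δ : ℝ} (hδ : 0 < δ) :
    ∃ G : Finset Γ, G.card = m ∧
      supFinsetSeminorm T ψ m k x ^ 2 - δ < finsetSeminorm T ψ k G x ^ 2 := by
  by_contra hno
  push Not at hno
  obtain ⟨G₀, hG₀⟩ := hne
  have h0 : 0 ≤ supFinsetSeminorm T ψ m k x ^ 2 - δ := (sq_nonneg _).trans (hno G₀ hG₀)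
  have h1 : supFinsetSeminorm T ψ m k x ≤ √(supFinsetSeminorm T ψ m k x ^ 2 - δ) := by
    nth_rewrite 1 [supFinsetSeminorm_apply hT hψ]
    exact Real.iSup_le (fun G => Real.le_sqrt_of_sq_le (hno G.1 G.2)) (Real.sqrt_nonneg _)
  have h2 := pow_le_pow_left₀ (apply_nonneg _ _) h1 2
  rw [Real.sq_sqrt h0] at h2
  linarith

/-- If `|T γ x|` is at least `η` on `G₀` and at most `η' < η` off `G₀`, then the convexity defect of
`ψ G₀` at `x` is controlled by the one of a suitable supremum seminorm. -/
theorem exists_convexityDefect_le {x : X} {G₀ : Finset Γ} {η η' : ℝ} (hη : η' < η)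
    (h1 : ∀ γ ∈ G₀, η ≤ |T γ x|) (h2 : ∀ γ ∉ G₀, |T γ x| ≤ η') :
    ∃ k : ℕ, ∃ c > 0, ∀ y, convexityDefect (supFinsetSeminorm T ψ G₀.card k) x y < (η - η') ^ 2 →
      c * convexityDefect (ψ G₀) x y ≤ convexityDefect (supFinsetSeminorm T ψ G₀.card k) x y := by
  classical
  set d := η - η' with hd_def
  have hd : 0 < d := sub_pos.2 hη
  set φ : Finset Γ → ℝ := fun G => ∑ γ ∈ G, |T γ x| with hφ
  have hφ0 : ∀ G, 0 ≤ φ G := fun G => Finset.sum_nonneg fun _ _ => abs_nonneg _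
  -- Replacing elements of `G₀` by the same number of outside elements costs at least `d` for each
  -- element.
  have hgap : ∀ G : Finset Γ, G.card = G₀.card → G ≠ G₀ → φ G + d ≤ φ G₀ := by
    intro G hG hne
    have hcard : (G₀ \ G).card = (G \ G₀).card := by
      have e1 := Finset.card_sdiff_add_card_inter G₀ G
      have e2 := Finset.card_sdiff_add_card_inter G G₀
      rw [Finset.inter_comm] at e2
      omega
    have hpos : 1 ≤ (G₀ \ G).card := by
      rw [Nat.one_le_iff_ne_zero]
      intro h0
      have hsub : G₀ ⊆ G := Finset.sdiff_eq_empty_iff_subset.1 (Finset.card_eq_zero.1 h0)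
      exact hne (Finset.eq_of_subset_of_card_le hsub hG.le).symm
    have e3 : ∑ γ ∈ G₀ \ G, |T γ x| - ∑ γ ∈ G \ G₀, |T γ x| = φ G₀ - φ G :=
      Finset.sum_sdiff_sub_sum_sdiff
    have e4 : (G₀ \ G).card • η ≤ ∑ γ ∈ G₀ \ G, |T γ x| :=
      Finset.card_nsmul_le_sum _ _ _ fun γ hγ => h1 γ (Finset.mem_sdiff.1 hγ).1
    have e5 : ∑ γ ∈ G \ G₀, |T γ x| ≤ (G \ G₀).card • η' :=
      Finset.sum_le_card_nsmul _ _ _ fun γ hγ => h2 γ (Finset.mem_sdiff.1 hγ).2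
    rw [nsmul_eq_mul] at e4 e5
    rw [← hcard] at e5
    have e6 : (1 : ℝ) ≤ ((G₀ \ G).card : ℝ) := by exact_mod_cast hpos
    have e7 : d ≤ ((G₀ \ G).card : ℝ) * d := by nlinarith
    have e8 : ((G₀ \ G).card : ℝ) * d = (G₀ \ G).card * η - (G₀ \ G).card * η' := by
      rw [hd_def]; ring
    linarith
  -- `k` is so large that the `ψ` term at `x` costs at most d²/2, half of the gap d² between the
  -- squared sums; a wrong `G` thus stays d²/2 below the supremum.
  obtain ⟨k, hk⟩ := exists_nat_one_div_lt (show (0 : ℝ) < d ^ 2 / (2 * (‖x‖ ^ 2 + 1)) by positivity)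
  set θ := supFinsetSeminorm T ψ G₀.card k with hθ
  have hc0 : (0 : ℝ) < (1 / ((k : ℝ) + 1)) ^ 2 := by positivity
  have hsmall : (1 / ((k : ℝ) + 1)) ^ 2 * ‖x‖ ^ 2 ≤ d ^ 2 / 2 := by
    have hle : (1 / ((k : ℝ) + 1)) ^ 2 ≤ 1 / ((k : ℝ) + 1) := by
      have : 1 / ((k : ℝ) + 1) ≤ 1 := by
        rw [div_le_one (by positivity)]; linarith [k.cast_nonneg (α := ℝ)]
      rw [sq]
      exact mul_le_of_le_one_left (by positivity) this
    calc (1 / ((k : ℝ) + 1)) ^ 2 * ‖x‖ ^ 2 ≤ (d ^ 2 / (2 * (‖x‖ ^ 2 + 1))) * (‖x‖ ^ 2 + 1) :=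
          mul_le_mul (hle.trans hk.le) (by linarith) (sq_nonneg _) (by positivity)
      _ = d ^ 2 / 2 := by field_simp
  have hsep : ∀ G : Finset Γ, G.card = G₀.card → G ≠ G₀ →
      finsetSeminorm T ψ k G x ^ 2 + d ^ 2 / 2 ≤ θ x ^ 2 := by
    intro G hG hne
    have e1 := hgap G hG hne
    have e2 : φ G₀ ^ 2 ≤ θ x ^ 2 := by
      refine le_trans ?_ (pow_le_pow_left₀ (apply_nonneg _ _)
        (finsetSeminorm_le_sup hT hψ k (rfl : G₀.card = G₀.card) x) 2)
      rw [finsetSeminorm_sq]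
      exact le_add_of_nonneg_right (by positivity)
    have e3 : ψ G x ^ 2 ≤ ‖x‖ ^ 2 := pow_le_pow_left₀ (apply_nonneg _ _) (hψ G x) 2
    have e4 : (1 / ((k : ℝ) + 1)) ^ 2 * ψ G x ^ 2 ≤ d ^ 2 / 2 :=
      (mul_le_mul_of_nonneg_left e3 hc0.le).trans hsmall
    rw [finsetSeminorm_sq]
    change φ G ^ 2 + _ + _ ≤ _
    nlinarith [hφ0 G]
  refine ⟨k, _, hc0, fun y hy => ?_⟩
  refine le_of_forall_pos_lt_add fun ε hε => ?_
  -- The first bound absorbs `ε`; the second makes the defect plus `δ` smaller than d², which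
  -- excludes every `G` other than `G₀`.
  set δ := min (ε / 2) ((d ^ 2 - convexityDefect θ x y) / 2) with hδ_def
  have hδ : 0 < δ := lt_min (by linarith) (by linarith)
  have hδ1 : δ ≤ ε / 2 := min_le_left _ _
  have hδ2 : δ ≤ (d ^ 2 - convexityDefect θ x y) / 2 := min_le_right _ _
  obtain ⟨G, hG, hlt⟩ := exists_sq_lt_finsetSeminorm_sq hT hψ k ⟨G₀, rfl⟩ (x + y) hδ
  set q := finsetSeminorm T ψ k G with hq
  have hqx : q x ^ 2 ≤ θ x ^ 2 :=
    pow_le_pow_left₀ (apply_nonneg _ _) (finsetSeminorm_le_sup hT hψ k hG x) 2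
  have hqy : q y ^ 2 ≤ θ y ^ 2 :=
    pow_le_pow_left₀ (apply_nonneg _ _) (finsetSeminorm_le_sup hT hψ k hG y) 2
  -- `q` is dominated by `θ` at `x` and `y` and nearly attains it at `x + y`; so the defect of `θ`
  -- also pays for the deficiency of `q` at `x`.
  have hsplit : convexityDefect q x y + 2 * (θ x ^ 2 - q x ^ 2) ≤ convexityDefect θ x y + δ := by
    unfold convexityDefect
    linarith
  have hGG : G = G₀ := by
    by_contra hne
    have e1 := hsep G hG hne
    have e2 := convexityDefect_nonneg q x y
    linarith
  have hψq : (1 / ((k : ℝ) + 1)) ^ 2 * convexityDefect (ψ G₀) x y ≤ convexityDefect q x y := by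
    have e1 := convexityDefect_le_hypotSeminorm_right (sumAbsSeminorm T G)
      ((1 / ((k : NNReal) + 1)) • ψ G) x y
    rw [convexityDefect_smul] at e1
    rw [← hGG, hq, finsetSeminorm]
    simpa using e1
  linarith

end FinsetSup

/-! ### The criterion for locally uniformly convex renorming. -/

section LUR

variable {X : Type*} [NormedAddCommGroup X] [NormedSpace ℝ X] {Γ : Type*}

/-- The quadratic mean (up to a normalising factor) of the functionals in `s`. -/
noncomputable def dualSeminorm (s : Finset (StrongDual ℝ X)) : Seminorm ℝ X :=
  l2Seminorm (fun ξ : s => (1 / ((s.card : NNReal) + 1)) • (normSeminorm ℝ ℝ).comp ξ.1.toLinearMap)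
    fun _ => Summable.of_finite

theorem dualSeminorm_le_norm {s : Finset (StrongDual ℝ X)} (hs : ∀ ξ ∈ s, ‖ξ‖ ≤ 1) (x : X) :
    dualSeminorm s x ≤ ‖x‖ := by
  refine le_of_sq_le_sq ?_ (norm_nonneg _)
  rw [dualSeminorm, l2Seminorm_sq, tsum_fintype]
  have h1 : ∀ ξ : s, ((1 / ((s.card : NNReal) + 1)) •
      (normSeminorm ℝ ℝ).comp ξ.1.toLinearMap) x ^ 2 ≤ 1 / ((s.card : ℝ) + 1) * ‖x‖ ^ 2 := by
    intro ξ
    have e1 : ‖ξ.1 x‖ ≤ ‖x‖ := (ξ.1.le_of_opNorm_le (hs ξ.1 ξ.2) x).trans_eq (one_mul _)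
    have e2 : ((1 / ((s.card : NNReal) + 1)) • (normSeminorm ℝ ℝ).comp ξ.1.toLinearMap) x =
        1 / ((s.card : ℝ) + 1) * ‖ξ.1 x‖ := by
      rw [smul_apply, NNReal.smul_def, smul_eq_mul]
      simp
    have e3 : 1 / ((s.card : ℝ) + 1) ≤ 1 := by
      rw [div_le_one (by positivity)]; linarith [s.card.cast_nonneg (α := ℝ)]
    have e4 : (0 : ℝ) < 1 / ((s.card : ℝ) + 1) := by positivity
    rw [e2, mul_pow]
    refine mul_le_mul ?_ (pow_le_pow_left₀ (norm_nonneg _) e1 2) (sq_nonneg _) e4.le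
    rw [sq]
    exact mul_le_of_le_one_left e4.le e3
  refine (Finset.sum_le_card_nsmul _ _ _ fun ξ _ => h1 ξ).trans ?_
  rw [nsmul_eq_mul, Finset.card_univ, Fintype.card_coe, ← mul_assoc, mul_one_div]
  refine mul_le_of_le_one_left (sq_nonneg _) ?_
  rw [div_le_one (by positivity)]
  linarith

/-- For |ξ| the parallelogram law makes the defect exactly (ξ x - ξ y)², so a vanishing defect
forces convergence under every functional in `s`. -/
theorem sq_sub_le_convexityDefect_dualSeminorm {s : Finset (StrongDual ℝ X)} {ξ : StrongDual ℝ X}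
    (hξ : ξ ∈ s) (x y : X) :
    (1 / ((s.card : ℝ) + 1)) ^ 2 * (ξ x - ξ y) ^ 2 ≤ convexityDefect (dualSeminorm s) x y := by
  have h1 := convexityDefect_le_l2Seminorm
    (fun ξ : s => (1 / ((s.card : NNReal) + 1)) • (normSeminorm ℝ ℝ).comp ξ.1.toLinearMap)
    (fun _ => Summable.of_finite) ⟨ξ, hξ⟩ x y
  rw [convexityDefect_smul] at h1
  refine le_trans (le_of_eq ?_) h1
  have h2 : convexityDefect ((normSeminorm ℝ ℝ).comp ξ.toLinearMap) x y = (ξ x - ξ y) ^ 2 := by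
    simp only [convexityDefect, Seminorm.comp_apply, coe_normSeminorm, Real.norm_eq_abs, sq_abs]
    change 2 * ξ x ^ 2 + 2 * ξ y ^ 2 - ξ (x + y) ^ 2 = _
    rw [map_add]
    ring
  rw [h2]
  simp

/-- `G₀` consists of all coordinates at least as large as the smallest one on `G`. Only finitely
many others exceed half of that value, which leaves a strict gap. -/
theorem exists_threshold {T : Γ → X →ₗ[ℝ] ℝ} (hT0 : ∀ x, ∀ η > 0, {γ | η ≤ |T γ x|}.Finite) (x : X)
    (G : Finset Γ) (hG : ∀ γ ∈ G, T γ x ≠ 0) :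
    ∃ G₀ : Finset Γ, G ⊆ G₀ ∧ ∃ η η' : ℝ, η' < η ∧ (∀ γ ∈ G₀, η ≤ |T γ x|) ∧
      ∀ γ ∉ G₀, |T γ x| ≤ η' := by
  classical
  obtain ⟨η, hη, hGη⟩ : ∃ η > 0, ∀ γ ∈ G, η ≤ |T γ x| := by
    rcases G.eq_empty_or_nonempty with rfl | hne
    · exact ⟨1, one_pos, by simp⟩
    · obtain ⟨γ, hγ, hmin⟩ := G.exists_min_image (fun γ => |T γ x|) hne
      exact ⟨|T γ x|, abs_pos.2 (hG γ hγ), hmin⟩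
  have hfin := hT0 x (η / 2) (by positivity)
  set G₀ := (hT0 x η hη).toFinset with hG₀
  have hmem : ∀ γ, γ ∈ G₀ ↔ η ≤ |T γ x| := fun γ => by rw [hG₀, Set.Finite.mem_toFinset]; rfl
  obtain ⟨η', h1, h2⟩ : ∃ η' < η, ∀ γ ∉ G₀, |T γ x| ≤ η' := by
    rcases (hfin.toFinset \ G₀).eq_empty_or_nonempty with he | hne
    · refine ⟨η / 2, by linarith, fun γ hγ => ?_⟩
      by_contra hlt
      have : γ ∈ hfin.toFinset \ G₀ :=
        Finset.mem_sdiff.2 ⟨hfin.mem_toFinset.2 (not_le.1 hlt).le, hγ⟩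
      rw [he] at this
      simp at this
    · obtain ⟨γ₁, hγ₁, hmax⟩ := Finset.exists_max_image _ (fun γ => |T γ x|) hne
      refine ⟨|T γ₁ x|, ?_, fun γ hγ => ?_⟩
      · exact not_le.1 fun h => (Finset.mem_sdiff.1 hγ₁).2 ((hmem _).2 h)
      · have e1 : η / 2 ≤ |T γ₁ x| := hfin.mem_toFinset.1 (Finset.mem_sdiff.1 hγ₁).1
        by_cases e2 : η / 2 ≤ |T γ x|
        · exact hmax γ (Finset.mem_sdiff.2 ⟨hfin.mem_toFinset.2 e2, hγ⟩)
        · linarith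
  exact ⟨G₀, fun γ hγ => (hmem γ).2 (hGη γ hγ), η, η', h1, fun γ hγ => (hmem γ).1 hγ, h2⟩

/-- A criterion for locally uniformly convex renorming, by means of a bounded family of linear
functionals that defines an operator into `c₀(Γ)`, and finite-dimensional subspaces indexed by the
finite subsets of `Γ`. -/
theorem exists_isEquivalentNorm_isLUR (T : Γ → X →ₗ[ℝ] ℝ) (hT : ∀ γ x, |T γ x| ≤ ‖x‖)
    (hT0 : ∀ x, ∀ η > 0, {γ | η ≤ |T γ x|}.Finite) (V : Finset Γ → Submodule ℝ X)
    (hfd : ∀ G, FiniteDimensional ℝ (V G)) (hmono : ∀ G G', G ⊆ G' → V G ≤ V G')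
    (hdense : ∀ x, ∀ ε > 0, ∃ G : Finset Γ, (∀ γ ∈ G, T γ x ≠ 0) ∧ ∃ h ∈ V G, ‖x - h‖ < ε) :
    ∃ N : Seminorm ℝ X, IsEquivalentNorm N ∧ IsLUR N := by
  classical
  choose s hs1 hs2 using fun G => exists_finset_norming (V G)
  set Ψ : Bool → Finset Γ → Seminorm ℝ X := fun b G =>
    cond b (distSeminorm (V G)) (dualSeminorm (s G)) with hΨ
  have hΨ1 : ∀ b G x, Ψ b G x ≤ ‖x‖ := by
    rintro (_ | _) G x
    · exact dualSeminorm_le_norm (hs1 G) x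
    · exact distSeminorm_le_norm (V G) x
  obtain ⟨N, hN, hdom⟩ := exists_isEquivalentNorm_dominating
    (fun i : Bool × ℕ × ℕ => supFinsetSeminorm T (Ψ i.1) i.2.1 i.2.2) (fun i => (i.2.1 : ℝ) + 1)
    (fun i x => supFinsetSeminorm_le hT (hΨ1 i.1) i.2.1 i.2.2 x)
  refine ⟨N, hN, fun x y h1 h2 => ?_⟩
  -- The two hypotheses of LUR enter only through this limit.
  have hD : Tendsto (fun n => convexityDefect N x (y n)) atTop (𝓝 0) := by
    have := ((tendsto_const_nhds (x := 2 * N x ^ 2)).add ((h1.pow 2).const_mul 2)).sub (h2.pow 2)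
    rwa [show 2 * N x ^ 2 + 2 * N x ^ 2 - (2 * N x) ^ 2 = 0 by ring] at this
  have hsub : ∀ (p : Seminorm ℝ X) (c : ℝ), 0 < c →
      (∀ᶠ n in atTop, c * convexityDefect p x (y n) ≤ convexityDefect N x (y n)) →
      Tendsto (fun n => convexityDefect p x (y n)) atTop (𝓝 0) := by
    intro p c hc hp
    have h3 : Tendsto (fun n => c⁻¹ * convexityDefect N x (y n)) atTop (𝓝 0) := by
      simpa using hD.const_mul c⁻¹
    refine tendsto_of_tendsto_of_tendsto_of_le_of_le' tendsto_const_nhds h3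
      (Eventually.of_forall fun n => convexityDefect_nonneg _ _ _) (hp.mono fun n hn => ?_)
    rw [inv_mul_eq_div, le_div_iff₀ hc, mul_comm]
    exact hn
  have hkey : ∀ (b : Bool) (G₀ : Finset Γ) (η η' : ℝ), η' < η → (∀ γ ∈ G₀, η ≤ |T γ x|) →
      (∀ γ ∉ G₀, |T γ x| ≤ η') →
      Tendsto (fun n => convexityDefect (Ψ b G₀) x (y n)) atTop (𝓝 0) := by
    intro b G₀ η η' hη ha hb
    obtain ⟨k, c, hc, hk⟩ := exists_convexityDefect_le hT (hΨ1 b) hη ha hb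
    obtain ⟨c', hc', hk'⟩ := hdom (b, G₀.card, k)
    have h3 := hsub _ c' hc' (Eventually.of_forall fun n => hk' x (y n))
    have hpos : 0 < (η - η') ^ 2 := pow_pos (sub_pos.2 hη) 2
    refine hsub _ (c' * c) (by positivity) ?_
    filter_upwards [h3.eventually (gt_mem_nhds hpos)] with n hn
    calc c' * c * convexityDefect (Ψ b G₀) x (y n)
        = c' * (c * convexityDefect (Ψ b G₀) x (y n)) := by ring
      _ ≤ c' * convexityDefect (supFinsetSeminorm T (Ψ b) G₀.card k) x (y n) :=
          mul_le_mul_of_nonneg_left (hk (y n) hn) hc'.le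
      _ ≤ _ := hk' x (y n)
  have hlim : Tendsto (fun n => ‖x - y n‖) atTop (𝓝 0) := by
    rw [Metric.tendsto_atTop']
    intro ε hε
    -- With `w` in `V G₀` near `y n`, three errors ε/9 bound ξ(v - w), the norming factor 2 gives
    -- 6ε/9 for v - w, and two more errors make 8ε/9.
    obtain ⟨G, hG, v, hv, hxv⟩ := hdense x (ε / 9) (by positivity)
    obtain ⟨G₀, hGG₀, η, η', hη, ha, hb⟩ := exists_threshold hT0 x G hG
    have hv₀ : v ∈ V G₀ := hmono _ _ hGG₀ hv
    have hdist := hkey true G₀ η η' hη ha hb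
    have hdual := hkey false G₀ η η' hη ha hb
    change Tendsto (fun n => convexityDefect (distSeminorm (V G₀)) x (y n)) atTop (𝓝 0) at hdist
    change Tendsto (fun n => convexityDefect (dualSeminorm (s G₀)) x (y n)) atTop (𝓝 0) at hdual
    set gap := ε / 9 - distSeminorm (V G₀) x with hgap_def
    have hgap : 0 < gap := by
      have := distSeminorm_le_norm_sub hv₀ x
      linarith
    set c := 1 / (((s G₀).card : ℝ) + 1) with hc_def
    have hc : 0 < c := by positivity
    have hsmall := hdual.eventually
      (gt_mem_nhds (show (0 : ℝ) < (c * (ε / 9)) ^ 2 by positivity))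
    have hsmall' := hdist.eventually (gt_mem_nhds (show (0 : ℝ) < gap ^ 2 by positivity))
    obtain ⟨n₀, hn₀⟩ := eventually_atTop.1 (hsmall.and hsmall')
    refine ⟨n₀, fun n hn => ?_⟩
    obtain ⟨e1, e2⟩ := hn₀ n hn.le
    have e3 : distSeminorm (V G₀) (y n) < ε / 9 := by
      have := (sq_sub_le_convexityDefect (distSeminorm (V G₀)) x (y n)).trans_lt e2
      have := abs_lt_of_sq_lt_sq this hgap.le
      rw [abs_lt] at this
      linarith
    obtain ⟨w, hw, hyw⟩ := exists_norm_sub_lt_of_distSeminorm_lt e3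
    have e4 : ∀ ξ ∈ s G₀, |ξ x - ξ (y n)| < ε / 9 := by
      intro ξ hξ
      have h5 := (sq_sub_le_convexityDefect_dualSeminorm hξ x (y n)).trans_lt e1
      rw [← mul_pow] at h5
      have h6 := abs_lt_of_sq_lt_sq h5 (by positivity)
      rw [abs_mul, abs_of_pos hc] at h6
      exact lt_of_mul_lt_mul_left h6 hc.le
    have e5 : ‖v - w‖ ≤ 6 * (ε / 9) := by
      by_cases hvw : v - w = 0
      · rw [hvw, norm_zero]; positivity
      · obtain ⟨ξ, hξ, hle⟩ := hs2 G₀ (v - w) ((V G₀).sub_mem hv₀ hw) hvw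
        have hξb : ∀ z, |ξ z| ≤ ‖z‖ := fun z =>
          (ξ.le_of_opNorm_le (hs1 G₀ ξ hξ) z).trans_eq (one_mul _)
        have h6 : ξ (v - w) = (ξ x - ξ (y n)) - ξ (x - v) + ξ (y n - w) := by
          simp only [map_sub]; ring
        have h7 : |ξ (v - w)| ≤ |ξ x - ξ (y n)| + |ξ (x - v)| + |ξ (y n - w)| := by
          rw [h6]
          exact (abs_add_le _ _).trans (add_le_add_left (abs_sub _ _) _)
        linarith [e4 ξ hξ, hξb (x - v), hξb (y n - w)]
    have e6 : ‖x - y n‖ ≤ ‖x - v‖ + ‖v - w‖ + ‖y n - w‖ := by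
      have : x - y n = (x - v) + (v - w) - (y n - w) := by abel
      rw [this]
      exact (norm_sub_le _ _).trans (add_le_add_left (norm_add_le _ _) _)
    rw [Real.dist_eq, sub_zero, abs_of_nonneg (norm_nonneg _)]
    linarith
  obtain ⟨_, C, _, _, hNC⟩ := hN
  have h3 : Tendsto (fun n => C * ‖x - y n‖) atTop (𝓝 0) := by simpa using hlim.const_mul C
  exact squeeze_zero (fun n => apply_nonneg _ _) (fun n => (hNC _).2) h3

end LUR

/-! ### Jump points, exit points and the functionals attached to them. -/

section TreeFunctionals

variable {Υ : Type*} [PartialOrder Υ]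

/-- The set of immediate successors of `t` at which `ρ` takes the same value as at `t`. -/
def levelSuccessors (ρ : Υ → ℝ) (t : Υ) : Set Υ := {u | t ⋖ u ∧ ρ u = ρ t}

/-- The points at which `ρ` jumps across (or to) the value `q`. -/
def jumpSet (ρ : Υ → ℝ) (q : ℝ) : Set Υ := {a | (∀ s < a, ρ s < q) ∧ q ≤ ρ a}

/-- The points with `k` immediate successors on the same level of `ρ`, such that `ρ` is at
least `q` at the other immediate successors. -/
def exitSet (ρ : Υ → ℝ) (q : ℝ) (k : ℕ) : Set Υ :=
  {t | ρ t < q ∧ (levelSuccessors ρ t).ncard = k ∧ ∀ u, t ⋖ u → ρ u ≠ ρ t → q ≤ ρ u}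

theorem IsGoodPoint.finite_levelSuccessors {ρ : Υ → ℝ} {t : Υ} (h : IsGoodPoint ρ t) :
    (levelSuccessors ρ t).Finite := by
  obtain ⟨F, -, hF, δ, hδ, hu⟩ := h
  refine hF.subset fun u hu' => ?_
  by_contra huF
  have := hu u ⟨hu'.1, huF⟩
  rw [hu'.2] at this
  linarith

/-- Off its own level, `ρ` on the immediate successors of a good point stays away from `ρ t`: by `δ`
outside `F`, by a finite minimum inside. A rational fits in between. -/
theorem IsGoodPoint.exists_mem_exitSet {ρ : Υ → ℝ} (hρ : Monotone ρ) {t : Υ}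
    (h : IsGoodPoint ρ t) : ∃ (q : ℚ) (k : ℕ), t ∈ exitSet ρ q k := by
  obtain ⟨F, -, hF, δ, hδ, hu⟩ := h
  obtain ⟨c, hc, hcF⟩ : ∃ c > ρ t, ∀ u ∈ F, t ⋖ u → ρ u ≠ ρ t → c ≤ ρ u := by
    rcases (F ∩ {u | t ⋖ u ∧ ρ u ≠ ρ t}).eq_empty_or_nonempty with he | hne
    · refine ⟨ρ t + 1, by linarith, fun u huF h1 h2 => ?_⟩
      have : u ∈ F ∩ {u | t ⋖ u ∧ ρ u ≠ ρ t} := ⟨huF, h1, h2⟩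
      rw [he] at this
      exact this.elim
    · obtain ⟨v, hv, hmin⟩ := Set.exists_min_image _ ρ (hF.inter_of_left _) hne
      exact ⟨ρ v, lt_of_le_of_ne (hρ hv.2.1.le) hv.2.2.symm,
        fun u huF h1 h2 => hmin u ⟨huF, h1, h2⟩⟩
  obtain ⟨q, hq1, hq2⟩ := exists_rat_btwn (show ρ t < min c (ρ t + δ) from lt_min hc (by linarith))
  refine ⟨q, _, hq1, rfl, fun u h1 h2 => ?_⟩
  by_cases huF : u ∈ F
  · exact hq2.le.trans ((min_le_left _ _).trans (hcF u huF h1 h2))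
  · exact hq2.le.trans ((min_le_right _ _).trans (hu u ⟨h1, huF⟩))

theorem jumpSet_eq_of_le {ρ : Υ → ℝ} {q : ℝ} {a b : Υ} (ha : a ∈ jumpSet ρ q)
    (hb : b ∈ jumpSet ρ q) (hab : a ≤ b) : a = b := by
  rcases hab.lt_or_eq with h | h
  · exact absurd ha.2 (not_le_of_gt (hb.1 a h))
  · exact h

variable [IsHausdorffTree Υ]

/-- The first point below `t` where `ρ` exceeds `ρ s` jumps across any rational between the two
values. -/
theorem exists_jumpSet_le {ρ : Υ → ℝ} {s t : Υ} (hst : s ≤ t) (h : ρ s < ρ t) (hρ : Monotone ρ) :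
    ∃ a, s ≤ a ∧ a ≤ t ∧ ρ s < ρ a ∧ ∃ q : ℚ, a ∈ jumpSet ρ q := by
  obtain ⟨a, ha, hmin⟩ := tree_exists_isLeast (S := {z | z ≤ t ∧ ρ s < ρ z}) (t := t)
    ⟨t, le_rfl, h⟩ (fun z hz => hz.1)
  obtain ⟨q, hq1, hq2⟩ := exists_rat_btwn ha.2
  have hsa : s ≤ a := by
    rcases tree_total hst ha.1 with h1 | h1
    · exact h1
    · exact absurd (hρ h1) (not_le_of_gt ha.2)
  refine ⟨a, hsa, ha.1, ha.2, q, fun z hz => ?_, hq2.le⟩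
  refine lt_of_le_of_lt (not_lt.1 fun h1 => ?_) hq1
  exact absurd (hmin ⟨hz.le.trans ha.1, h1⟩) (not_le_of_gt hz)

variable [TopologicalSpace Υ] [HasTreeTopology Υ]

/-- A jump set is an antichain, so it meets each of the finitely many chains covering {|f| ≥ η} at
most once. -/
theorem finite_jumpSet_le_abs {ρ : Υ → ℝ} (q : ℝ) (f : C₀(Υ, ℝ)) {η : ℝ} (hη : 0 < η) :
    {a | a ∈ jumpSet ρ q ∧ η ≤ |f a|}.Finite := by
  obtain ⟨F, -, hF⟩ := tree_finite_cover f (S := Set.univ) (fun s _ => ⟨s, trivial, le_rfl⟩) hη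
  refine (F.finite_toSet.biUnion (t := fun x => {a | a ∈ jumpSet ρ q ∧ a ≤ x}) fun x _ => ?_).subset
    fun a ha => ?_
  · refine Set.Subsingleton.finite fun a ha b hb => ?_
    rcases tree_total ha.2 hb.2 with h | h
    · exact jumpSet_eq_of_le ha.1 hb.1 h
    · exact (jumpSet_eq_of_le hb.1 ha.1 h).symm
  · obtain ⟨x, hx, hax⟩ := hF a ha.2
    exact Set.mem_biUnion hx ⟨ha.1, hax⟩

/-- The functional `f ↦ f t - ∑ f u`, the sum being over the immediate successors `u` of `t` on the
same level of `ρ`. -/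
noncomputable def exitFunctional {ρ : Υ → ℝ} (hfin : ∀ t, (levelSuccessors ρ t).Finite) (t : Υ) :
    C₀(Υ, ℝ) →ₗ[ℝ] ℝ :=
  c0Eval t - ∑ u ∈ (hfin t).toFinset, c0Eval u

variable {ρ : Υ → ℝ} (hfin : ∀ t, (levelSuccessors ρ t).Finite)

omit [IsHausdorffTree Υ] [HasTreeTopology Υ] in
theorem exitFunctional_apply (t : Υ) (f : C₀(Υ, ℝ)) :
    exitFunctional hfin t f = f t - ∑ u ∈ (hfin t).toFinset, f u := by
  simp [exitFunctional]

omit [IsHausdorffTree Υ] [HasTreeTopology Υ] in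
theorem abs_exitFunctional_le (t : Υ) (f : C₀(Υ, ℝ)) :
    |exitFunctional hfin t f| ≤ (((levelSuccessors ρ t).ncard : ℝ) + 1) * ‖f‖ := by
  rw [exitFunctional_apply]
  have h1 : |∑ u ∈ (hfin t).toFinset, f u| ≤ (levelSuccessors ρ t).ncard * ‖f‖ := by
    refine (Finset.abs_sum_le_sum_abs _ _).trans ?_
    refine (Finset.sum_le_card_nsmul _ _ ‖f‖ fun u _ => c0_abs_apply_le f u).trans_eq ?_
    rw [nsmul_eq_mul, Set.ncard_eq_toFinset_card _ (hfin t)]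
  have h2 := c0_abs_apply_le f t
  have h3 := abs_sub (f t) (∑ u ∈ (hfin t).toFinset, f u)
  linarith

/-- If `t < x` and the path to `x` stays on the level of `t` at the next step, exactly one term of
the sum is 1 and it cancels the value at `t`. -/
theorem exitFunctional_treeChi {t x : Υ} (h : exitFunctional hfin t (treeChi x) ≠ 0) :
    t = x ∨ (t < x ∧ ∃ u, t ⋖ u ∧ u ≤ x ∧ ρ u ≠ ρ t) := by
  by_contra hno
  push Not at hno
  obtain ⟨hne, hno⟩ := hno
  apply h
  rw [exitFunctional_apply]
  by_cases htx : t ≤ x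
  · have hlt := lt_of_le_of_ne htx hne
    obtain ⟨u, hu, hux⟩ := tree_exists_covBy_le hlt
    have hmem : u ∈ (hfin t).toFinset := (hfin t).mem_toFinset.2 ⟨hu, hno hlt u hu hux⟩
    rw [Finset.sum_eq_single_of_mem u hmem, treeChi_of_le htx, treeChi_of_le hux, sub_self]
    intro v hv hvu
    refine treeChi_of_not_le fun hvx => hvu ?_
    exact tree_covBy_unique ((hfin t).mem_toFinset.1 hv).1 hvx hu hux
  · rw [treeChi_of_not_le htx, Finset.sum_eq_zero, sub_zero]
    intro u hu
    exact treeChi_of_not_le fun hux => htx (((hfin t).mem_toFinset.1 hu).1.le.trans hux)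

/-- Below `x` at most one point of the exit set has a path to `x` leaving its level at the next
step, since `ρ` is at least `q` from then on. Finiteness follows on the span of indicators, and then
by density because the functionals have norm at most `k + 1` on the exit set. -/
theorem finite_exitSet_le_abs (hρ : Monotone ρ) (q : ℝ) (k : ℕ) (f : C₀(Υ, ℝ)) {η : ℝ}
    (hη : 0 < η) : {t | t ∈ exitSet ρ q k ∧ η ≤ |exitFunctional hfin t f|}.Finite := by
  have hspan : ∀ h ∈ Submodule.span ℝ (Set.range (treeChi (Υ := Υ))),
      {t | t ∈ exitSet ρ q k ∧ exitFunctional hfin t h ≠ 0}.Finite := by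
    intro h hh
    induction hh using Submodule.span_induction with
    | mem h hh =>
      obtain ⟨x, rfl⟩ := hh
      refine ((Set.finite_singleton x).union (Set.Subsingleton.finite
        (s := {t | t ∈ exitSet ρ q k ∧ t < x ∧ ∃ u, t ⋖ u ∧ u ≤ x ∧ ρ u ≠ ρ t}) ?_)).subset ?_
      · have key : ∀ t t' : Υ, t' ∈ exitSet ρ q k → t' < x → t ∈ exitSet ρ q k →
            (∃ u, t ⋖ u ∧ u ≤ x ∧ ρ u ≠ ρ t) → t ≤ t' → t = t' := by
          rintro t t' ht' ht'x ht ⟨u, hu, hux, hne⟩ hle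
          by_contra hne'
          have h1 := tree_covBy_le hu hux (lt_of_le_of_ne hle hne') ht'x.le
          linarith [hρ h1, ht.2.2 u hu hne, ht'.1]
        intro t ht t' ht'
        rcases tree_total ht.2.1.le ht'.2.1.le with h | h
        · exact key t t' ht'.1 ht'.2.1 ht.1 ht.2.2 h
        · exact (key t' t ht.1 ht.2.1 ht'.1 ht'.2.2 h).symm
      · intro t ht
        rcases exitFunctional_treeChi hfin ht.2 with h | h
        · exact Or.inl h
        · exact Or.inr ⟨ht.1, h⟩
    | zero => simp
    | add g h _ _ ihg ihh =>
      refine (ihg.union ihh).subset fun t ht => ?_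
      by_contra hno
      have h1 : exitFunctional hfin t g = 0 := by
        by_contra h0; exact hno (Or.inl ⟨ht.1, h0⟩)
      have h2 : exitFunctional hfin t h = 0 := by
        by_contra h0; exact hno (Or.inr ⟨ht.1, h0⟩)
      exact ht.2 (by rw [map_add, h1, h2, add_zero])
    | smul a h _ ih =>
      refine ih.subset fun t ht => ⟨ht.1, fun h0 => ht.2 ?_⟩
      rw [map_smul, h0, smul_zero]
  obtain ⟨h, hh, hfh⟩ := exists_mem_span_treeChi_norm_sub_lt f
    (show 0 < η / ((k : ℝ) + 1) by positivity)
  refine (hspan h hh).subset fun t ht => ⟨ht.1, fun h0 => ?_⟩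
  have h1 := abs_exitFunctional_le hfin t (f - h)
  rw [map_sub, h0, sub_zero, ht.1.2.1] at h1
  rw [lt_div_iff₀ (by positivity)] at hfh
  linarith [ht.2]

/-- A function all of whose `exitFunctional`s and values at jump points vanish above `u`
vanishes at `u`. -/
theorem eq_zero_of_exitFunctional_eq_zero (hρ : Monotone ρ)
    (hbranch : ∀ Γ : Set Υ, Γ.Nonempty → IsEverBranching Γ → ¬ ∃ c : ℝ, ∀ t ∈ Γ, ρ t = c)
    (f : C₀(Υ, ℝ)) (u : Υ) (hexit : ∀ t, u ≤ t → exitFunctional hfin t f = 0)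
    (hjump : ∀ a, u ≤ a → (∃ q : ℚ, a ∈ jumpSet ρ q) → f a = 0) : f u = 0 := by
  by_contra hu
  set Γ : Set Υ := {t | u ≤ t ∧ f t ≠ 0 ∧ ρ t = ρ u} with hΓ
  have hnot : ¬ IsEverBranching Γ := fun h =>
    hbranch Γ ⟨u, le_rfl, hu, rfl⟩ h ⟨ρ u, fun t ht => ht.2.2⟩
  unfold IsEverBranching at hnot
  push Not at hnot
  obtain ⟨t, ht, hchain⟩ := hnot
  -- `C` follows the unique branch of `Γ` above `t` as long as `f` and `ρ` keep their values. Its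
  -- last point `z` will turn out to have a successor in `C`, a contradiction.
  set C : Set Υ := {s | t ≤ s ∧ ∀ z, t ≤ z → z ≤ s → f z = f t ∧ ρ z = ρ u} with hC
  have htC : t ∈ C := ⟨le_rfl, fun z h1 h2 => by rw [le_antisymm h2 h1]; exact ⟨rfl, ht.2.2⟩⟩
  have hCΓ : ∀ s ∈ C, s ∈ Γ ∩ Set.Ici t := fun s hs =>
    ⟨⟨ht.1.trans hs.1, by rw [(hs.2 s hs.1 le_rfl).1]; exact ht.2.1, (hs.2 s hs.1 le_rfl).2⟩, hs.1⟩
  have hCtot : ∀ s ∈ C, ∀ s' ∈ C, s ≤ s' ∨ s' ≤ s := fun s hs s' hs' =>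
    hchain.total (hCΓ s hs) (hCΓ s' hs')
  obtain ⟨F, -, hF⟩ := tree_finite_cover f (S := Set.univ) (fun s _ => ⟨s, trivial, le_rfl⟩)
    (abs_pos.2 ht.2.1)
  -- Finitely many initial segments cover {|f| ≥ |f t|}; as `C` is a chain inside this set, one of
  -- them contains it.
  have hbound : ∃ x, ∀ s ∈ C, s ≤ x := by
    by_contra hno
    push Not at hno
    choose g hgC hg using hno
    have hFin : ∀ G : Finset Υ, ∃ s ∈ C, ∀ x ∈ G, ¬ s ≤ x := by
      classical
      intro G
      induction G using Finset.induction_on with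
      | empty => exact ⟨t, htC, by simp⟩
      | insert a G _ ih =>
        obtain ⟨s, hs, hsG⟩ := ih
        rcases hCtot s hs (g a) (hgC a) with h | h
        · refine ⟨g a, hgC a, fun x hx => ?_⟩
          rcases Finset.mem_insert.1 hx with rfl | hx
          · exact hg x
          · exact fun h' => hsG x hx (h.trans h')
        · refine ⟨s, hs, fun x hx => ?_⟩
          rcases Finset.mem_insert.1 hx with rfl | hx
          · exact fun h' => hg x (h.trans h')
          · exact hsG x hx
    obtain ⟨s, hs, hsF⟩ := hFin F
    obtain ⟨x, hx, hsx⟩ := hF s (by rw [(hs.2 s hs.1 le_rfl).1])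
    exact hsF x hx hsx
  obtain ⟨x, hx⟩ := hbound
  obtain ⟨z, ⟨hzx, hzub⟩, hzmin⟩ := tree_exists_isLeast (S := {z | z ≤ x ∧ ∀ s ∈ C, s ≤ z}) (t := x)
    ⟨x, le_rfl, hx⟩ (fun z hz => hz.1)
  have htz : t ≤ z := hzub t htC
  have hbelow : ∀ w < z, ∃ s ∈ C, w ≤ s := by
    intro w hw
    by_contra hno
    push Not at hno
    refine absurd (hzmin ⟨hw.le.trans hzx, fun s hs => ?_⟩) (not_le_of_gt hw)
    rcases tree_total (hzub s hs) hw.le with h | h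
    · exact h
    · exact absurd h (hno s hs)
  have hbelow' : ∀ w < z, t ≤ w → f w = f t ∧ ρ w = ρ u := fun w hw htw => by
    obtain ⟨s, hs, hws⟩ := hbelow w hw
    exact hs.2 w htw hws
  have hfz : f z = f t := by
    by_cases hzt : z = t
    · rw [hzt]
    by_contra hne
    have hopen : IsOpen {w | f w ≠ f t} := isOpen_ne_fun f.continuous continuous_const
    have htlt : t < z := lt_of_le_of_ne htz (Ne.symm hzt)
    rcases tree_exists_Ioc_subset hopen (t := z) hne with h | ⟨w, hw, h⟩
    · exact h (Set.mem_Iic.2 htz) rfl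
    · by_cases hzC : z ∈ C
      · exact hne (hzC.2 z htz le_rfl).1
      obtain ⟨s, hs, hws, hts⟩ : ∃ s ∈ C, w < s ∧ t ≤ s := by
        by_contra hno
        push Not at hno
        have hCw : ∀ s ∈ C, s ≤ w := fun s hs => by
          rcases tree_total (hzub s hs) hw.le with h1 | h1
          · exact h1
          · rcases h1.lt_or_eq with h2 | h2
            · exact absurd hs.1 (hno s hs h2)
            · exact h2.ge
        exact absurd (hzmin ⟨hw.le.trans hzx, hCw⟩) (not_le_of_gt hw)
      exact h ⟨hws, hzub s hs⟩ (hs.2 s hts le_rfl).1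
  -- Otherwise `ρ` jumps at `z` itself, where `f` would have to vanish.
  have hρz : ρ z = ρ u := by
    refine (hρ (ht.1.trans htz)).antisymm' (not_lt.1 fun hlt => ?_)
    obtain ⟨a, hua, haz, hlt', hq⟩ := exists_jumpSet_le (ht.1.trans htz) hlt hρ
    have hta : z = a := by
      by_contra hne
      have haz' : a < z := lt_of_le_of_ne haz (Ne.symm hne)
      obtain ⟨s, hs, has⟩ := hbelow a haz'
      have := hρ has
      rw [(hs.2 s hs.1 le_rfl).2] at this
      linarith
    refine ht.2.1 ?_
    rw [← hfz, hta]
    exact hjump a hua hq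
  have hzC : z ∈ C := ⟨htz, fun w htw hwz => by
    rcases hwz.lt_or_eq with h | rfl
    · exact hbelow' w h htw
    · exact ⟨hfz, hρz⟩⟩
  have hsum := hexit z (ht.1.trans htz)
  rw [exitFunctional_apply, sub_eq_zero, hfz] at hsum
  obtain ⟨v, hv, hv0⟩ := Finset.exists_ne_zero_of_sum_ne_zero (hsum ▸ ht.2.1)
  have hlev : ∀ v ∈ (hfin z).toFinset, z ⋖ v ∧ ρ v = ρ u := fun v hv => by
    have := (hfin z).mem_toFinset.1 hv
    exact ⟨this.1, this.2.trans hρz⟩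
  have hmem : ∀ v ∈ (hfin z).toFinset, f v ≠ 0 → v ∈ Γ ∩ Set.Ici t := fun v hv h0 =>
    ⟨⟨ht.1.trans (htz.trans (hlev v hv).1.le), h0, (hlev v hv).2⟩, htz.trans (hlev v hv).1.le⟩
  -- Distinct immediate successors of `z` are incomparable, while `Γ` above `t` is a chain; so one
  -- successor carries the whole value `f z`.
  have huniq : ∀ w ∈ (hfin z).toFinset, w ≠ v → f w = 0 := by
    intro w hw hwv
    by_contra h0
    rcases hchain.total (hmem w hw h0) (hmem v hv hv0) with h | h
    · exact hwv (tree_covBy_unique (hlev w hw).1 h (hlev v hv).1 le_rfl)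
    · exact hwv (tree_covBy_unique (hlev w hw).1 le_rfl (hlev v hv).1 h)
  rw [Finset.sum_eq_single_of_mem v hv huniq] at hsum
  have hvC : v ∈ C := ⟨htz.trans (hlev v hv).1.le, fun w htw hwv => by
    rcases hwv.lt_or_eq with h | rfl
    · exact hzC.2 w htw (tree_le_of_lt_covBy (hlev v hv).1 h)
    · exact ⟨hsum.symm, (hlev w hv).2⟩⟩
  exact absurd (hzub v hvC) (hlev v hv).1.lt.not_ge

end TreeFunctionals

/-! ### Renorming C₀ from a function ρ without bad points. -/

section TreeLUR

variable {Υ : Type*} [PartialOrder Υ] [IsHausdorffTree Υ] [TopologicalSpace Υ] [HasTreeTopology Υ]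
  {ρ : Υ → ℝ}

/-- If `f` changes between `y` and its successor `y'` below `x ∈ S`, and `y` is not in `S`, then `f
y` is the sum of `f` over the level successors, and `f` vanishes at the other successors because
predecessors of active jump points are in `S`. So `f` is nonzero at some successor other than `y'`;
it lies below some `x' ∈ S`, and `y` is the meet of `x` and `x'`. -/
theorem mem_closure_span_of_functionals (hρ : Monotone ρ)
    (hfin : ∀ t, (levelSuccessors ρ t).Finite)
    (hbranch : ∀ Γ : Set Υ, Γ.Nonempty → IsEverBranching Γ → ¬ ∃ c : ℝ, ∀ t ∈ Γ, ρ t = c)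
    (f : C₀(Υ, ℝ)) {S : Set Υ} (hexit : ∀ t, exitFunctional hfin t f ≠ 0 → t ∈ S)
    (hjump : ∀ a, (∃ q : ℚ, a ∈ jumpSet ρ q) → f a ≠ 0 → a ∈ S ∧ ∀ z, z ⋖ a → z ∈ S) :
    f ∈ (Submodule.span ℝ (treeChi ''
      {m | ∃ x ∈ S, ∃ y ∈ S, IsGreatest (Set.Iic x ∩ Set.Iic y) m})).topologicalClosure := by
  set M : Set Υ := {m | ∃ x ∈ S, ∃ y ∈ S, IsGreatest (Set.Iic x ∩ Set.Iic y) m} with hM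
  have hMY : ∀ m ∈ M, treeChi m ∈ (Submodule.span ℝ (treeChi '' M)).topologicalClosure :=
    fun m hm => Submodule.le_topologicalClosure _ (Submodule.subset_span ⟨m, hm, rfl⟩)
  have hS : ∀ s, f s ≠ 0 → ∃ x ∈ S, s ≤ x := by
    intro s hs
    by_contra hno
    push Not at hno
    refine hs (eq_zero_of_exitFunctional_eq_zero hfin hρ hbranch f s (fun t hst => ?_)
      (fun a hsa hq => ?_))
    · by_contra h0
      exact hno t (hexit t h0) hst
    · by_contra h0
      exact hno a (hjump a hq h0).1 hsa
  refine mem_of_forall_treeChi_meet_mem (Submodule.isClosed_topologicalClosure _) f hS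
    (fun x hx y hy m hm => hMY m ⟨x, hx, y, hy, hm⟩) (fun x hx y hyx y' hyy' hy'x => ?_)
  by_contra hno
  push Not at hno
  obtain ⟨hne, hyY⟩ := hno
  have hyS : y ∉ S := fun h => hyY (hMY y ⟨y, h, y, h, ⟨le_rfl, le_rfl⟩, fun z hz => hz.1⟩)
  have hsum : f y = ∑ u ∈ (hfin y).toFinset, f u := by
    rw [← sub_eq_zero, ← exitFunctional_apply]
    by_contra h0
    exact hyS (hexit y h0)
  have hw : ∀ w, y ⋖ w → ρ w ≠ ρ y → f w = 0 := by
    intro w hyw hne'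
    by_contra h0
    obtain ⟨q, hq1, hq2⟩ := exists_rat_btwn (lt_of_le_of_ne (hρ hyw.le) hne'.symm)
    exact hyS ((hjump w ⟨q, fun s hs => (hρ (tree_le_of_lt_covBy hyw hs)).trans_lt hq1, hq2.le⟩
      h0).2 y hyw)
  obtain ⟨u, hu, huy', hu0⟩ : ∃ u ∈ (hfin y).toFinset, u ≠ y' ∧ f u ≠ 0 := by
    by_contra hno
    push Not at hno
    by_cases hmem : y' ∈ (hfin y).toFinset
    · rw [Finset.sum_eq_single_of_mem y' hmem hno] at hsum
      exact hne hsum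
    · have h1 : f y' = 0 := hw y' hyy' fun h => hmem ((hfin y).mem_toFinset.2 ⟨hyy', h⟩)
      rw [Finset.sum_eq_zero fun v hv => hno v hv fun h => hmem (h ▸ hv)] at hsum
      exact hne (hsum.trans h1.symm)
  have hyu : y ⋖ u := ((hfin y).mem_toFinset.1 hu).1
  obtain ⟨x', hx', hux'⟩ := hS u hu0
  refine hyY (hMY y ⟨x, hx, x', hx', ⟨hyx.le, hyu.le.trans hux'⟩, fun z hz => ?_⟩)
  rcases tree_total hz.1 hyx.le with h | h
  · exact h
  · rcases h.lt_or_eq with h1 | h1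
    · exact absurd (tree_covBy_unique hyu (tree_covBy_le hyu hux' h1 hz.2) hyy'
        (tree_covBy_le hyy' hy'x h1 hz.1)) huy'
    · exact h1.ge

open Classical in
/-- Evaluations at jump points and normalised exit functionals. -/
noncomputable def treeBaseFunctional (hfin : ∀ t, (levelSuccessors ρ t).Finite) :
    ℚ ⊕ ℚ × ℕ → Υ → C₀(Υ, ℝ) →ₗ[ℝ] ℝ
  | Sum.inl q, a => if a ∈ jumpSet ρ q then c0Eval a else 0
  | Sum.inr (q, k), t =>
    if t ∈ exitSet ρ q k then (1 / ((k : ℝ) + 1)) • exitFunctional hfin t else 0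

omit [IsHausdorffTree Υ] [HasTreeTopology Υ] in
theorem abs_treeBaseFunctional_le (hfin : ∀ t, (levelSuccessors ρ t).Finite) (i : ℚ ⊕ ℚ × ℕ)
    (t : Υ) (f : C₀(Υ, ℝ)) : |treeBaseFunctional hfin i t f| ≤ ‖f‖ := by
  rcases i with q | ⟨q, k⟩
  · by_cases ht : t ∈ jumpSet ρ q
    · simpa [treeBaseFunctional, ht] using c0_abs_apply_le f t
    · simp [treeBaseFunctional, ht]
  · by_cases ht : t ∈ exitSet ρ q k
    · have h1 := abs_exitFunctional_le hfin t f
      rw [ht.2.1] at h1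
      simp only [treeBaseFunctional, ht, if_true, LinearMap.smul_apply, smul_eq_mul]
      rw [abs_mul, abs_of_pos (by positivity), one_div, inv_mul_le_iff₀ (by positivity)]
      exact h1
    · simp [treeBaseFunctional, ht]

theorem finite_treeBaseFunctional (hρ : Monotone ρ) (hfin : ∀ t, (levelSuccessors ρ t).Finite)
    (i : ℚ ⊕ ℚ × ℕ) (f : C₀(Υ, ℝ)) {η : ℝ} (hη : 0 < η) :
    {t | η ≤ |treeBaseFunctional hfin i t f|}.Finite := by
  rcases i with q | ⟨q, k⟩
  · refine (finite_jumpSet_le_abs (ρ := ρ) q f hη).subset fun t ht => ?_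
    by_cases hm : t ∈ jumpSet ρ q
    · exact ⟨hm, by simpa [treeBaseFunctional, hm] using ht⟩
    · simp only [treeBaseFunctional, hm, if_false, Set.mem_ofPred_eq, LinearMap.zero_apply,
        abs_zero] at ht
      linarith
  · refine (finite_exitSet_le_abs hfin hρ q k f
      (show 0 < η * ((k : ℝ) + 1) by positivity)).subset fun t ht => ?_
    by_cases hm : t ∈ exitSet ρ q k
    · refine ⟨hm, ?_⟩
      simp only [treeBaseFunctional, hm, if_true, Set.mem_ofPred_eq, LinearMap.smul_apply,
        smul_eq_mul] at ht
      rw [abs_mul, abs_of_pos (by positivity), one_div, inv_mul_eq_div,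
        le_div_iff₀ (by positivity)] at ht
      exact ht
    · simp only [treeBaseFunctional, hm, if_false, Set.mem_ofPred_eq, LinearMap.zero_apply,
        abs_zero] at ht
      linarith

/-- The functionals `treeBaseFunctional`, weighted so that together they define an operator
into `c₀`. -/
noncomputable def treeFunctional (hfin : ∀ t, (levelSuccessors ρ t).Finite)
    (γ : (ℚ ⊕ ℚ × ℕ) × Υ) : C₀(Υ, ℝ) →ₗ[ℝ] ℝ :=
  ((1 / 2 : ℝ) ^ Encodable.encode γ.1) • treeBaseFunctional hfin γ.1 γ.2

omit [IsHausdorffTree Υ] [HasTreeTopology Υ] in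
theorem treeFunctional_ne_zero (hfin : ∀ t, (levelSuccessors ρ t).Finite) {γ : (ℚ ⊕ ℚ × ℕ) × Υ}
    {f : C₀(Υ, ℝ)} (h : treeBaseFunctional hfin γ.1 γ.2 f ≠ 0) : treeFunctional hfin γ f ≠ 0 :=
  mul_ne_zero (by positivity) h

omit [IsHausdorffTree Υ] [HasTreeTopology Υ] in
theorem abs_treeFunctional (hfin : ∀ t, (levelSuccessors ρ t).Finite) (γ : (ℚ ⊕ ℚ × ℕ) × Υ)
    (f : C₀(Υ, ℝ)) : |treeFunctional hfin γ f| =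
      (1 / 2 : ℝ) ^ Encodable.encode γ.1 * |treeBaseFunctional hfin γ.1 γ.2 f| := by
  rw [treeFunctional, LinearMap.smul_apply, smul_eq_mul, abs_mul, abs_of_pos (by positivity)]

omit [IsHausdorffTree Υ] [HasTreeTopology Υ] in
theorem abs_treeFunctional_le (hfin : ∀ t, (levelSuccessors ρ t).Finite) (γ : (ℚ ⊕ ℚ × ℕ) × Υ)
    (f : C₀(Υ, ℝ)) : |treeFunctional hfin γ f| ≤ ‖f‖ := by
  rw [abs_treeFunctional]
  exact (mul_le_of_le_one_left (abs_nonneg _) (pow_le_one₀ (by norm_num) (by norm_num))).trans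
    (abs_treeBaseFunctional_le hfin γ.1 γ.2 f)

/-- The weights leave only finitely many indices `i` that can reach `η`, and each of these
contributes finitely many points. -/
theorem finite_treeFunctional (hρ : Monotone ρ) (hfin : ∀ t, (levelSuccessors ρ t).Finite)
    (f : C₀(Υ, ℝ)) {η : ℝ} (hη : 0 < η) : {γ | η ≤ |treeFunctional hfin γ f|}.Finite := by
  have h1 : Tendsto (fun i : ℚ ⊕ ℚ × ℕ => (1 / 2 : ℝ) ^ Encodable.encode i * ‖f‖) cofinite (𝓝 0) := by
    have := (summable_geometric_two_encode (ι := ℚ ⊕ ℚ × ℕ)).tendsto_cofinite_zero.mul_const ‖f‖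
    rwa [zero_mul] at this
  have h2 := h1.eventually (gt_mem_nhds hη)
  rw [eventually_cofinite] at h2
  refine (h2.biUnion (t := fun i => Prod.mk i '' {t | η ≤ |treeBaseFunctional hfin i t f|})
    fun i _ => (finite_treeBaseFunctional hρ hfin i f hη).image _).subset ?_
  rintro ⟨i, t⟩ ht
  have ht' : η ≤ |treeFunctional hfin (i, t) f| := ht
  rw [abs_treeFunctional] at ht'
  refine Set.mem_biUnion (x := i) ?_ ⟨t, ?_, rfl⟩
  · change ¬ _ < η
    rw [not_lt]
    exact ht'.trans
      (mul_le_mul_of_nonneg_left (abs_treeBaseFunctional_le hfin i t f) (by positivity))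
  · exact ht'.trans (mul_le_of_le_one_left (abs_nonneg _) (pow_le_one₀ (by norm_num) (by norm_num)))

/-- The second coordinates of the elements of `G`, together with their immediate predecessors. -/
def pointsWithPredecessors {ι Υ : Type*} [PartialOrder Υ] (G : Set (ι × Υ)) : Set Υ :=
  {z | ∃ γ ∈ G, z = γ.2 ∨ z ⋖ γ.2}

/-- The meets of pairs of elements of `S`. -/
def meetSet {Υ : Type*} [PartialOrder Υ] (S : Set Υ) : Set Υ :=
  {m | ∃ x ∈ S, ∃ y ∈ S, IsGreatest (Set.Iic x ∩ Set.Iic y) m}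

theorem pointsWithPredecessors_mono {ι Υ : Type*} [PartialOrder Υ] {G G' : Set (ι × Υ)}
    (h : G ⊆ G') : pointsWithPredecessors G ⊆ pointsWithPredecessors G' :=
  fun _ ⟨γ, hγ, hz⟩ => ⟨γ, h hγ, hz⟩

theorem meetSet_mono {Υ : Type*} [PartialOrder Υ] {S S' : Set Υ} (h : S ⊆ S') :
    meetSet S ⊆ meetSet S' :=
  fun _ ⟨x, hx, y, hy, hm⟩ => ⟨x, h hx, y, h hy, hm⟩

theorem finite_pointsWithPredecessors {ι Υ : Type*} [PartialOrder Υ] [IsHausdorffTree Υ]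
    {G : Set (ι × Υ)} (hG : G.Finite) : (pointsWithPredecessors G).Finite := by
  refine (hG.biUnion (t := fun γ => {γ.2} ∪ {z | z ⋖ γ.2}) fun γ _ =>
    (Set.finite_singleton _).union
      (Set.Subsingleton.finite fun a ha b hb => tree_pred_unique ha hb)).subset ?_
  rintro z ⟨γ, hγ, hz⟩
  exact Set.mem_biUnion hγ hz

theorem finite_meetSet {Υ : Type*} [PartialOrder Υ] {S : Set Υ} (hS : S.Finite) :
    (meetSet S).Finite := by
  refine (hS.biUnion (t := fun x => ⋃ y ∈ S, {m | IsGreatest (Set.Iic x ∩ Set.Iic y) m}) fun x _ =>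
    hS.biUnion fun y _ => Set.Subsingleton.finite fun a ha b hb => ha.unique hb).subset ?_
  rintro m ⟨x, hx, y, hy, hm⟩
  exact Set.mem_biUnion hx (Set.mem_biUnion hy hm)

theorem exists_finset_meetSet {ι Υ : Type*} [PartialOrder Υ] {P : Set (ι × Υ)} {m : Υ}
    (hm : m ∈ meetSet (pointsWithPredecessors P)) :
    ∃ G : Finset (ι × Υ), ↑G ⊆ P ∧ m ∈ meetSet (pointsWithPredecessors (G : Set (ι × Υ))) := by
  classical
  obtain ⟨x, ⟨γ, hγ, hx⟩, y, ⟨γ', hγ', hy⟩, hm⟩ := hm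
  refine ⟨{γ, γ'}, ?_, x, ⟨γ, by simp, hx⟩, y, ⟨γ', by simp, hy⟩, hm⟩
  intro z hz
  have hz' : z = γ ∨ z = γ' := by simpa using hz
  rcases hz' with rfl | rfl
  · exact hγ
  · exact hγ'

theorem exists_isLUR_of_monotone (hρ : Monotone ρ)
    (hbranch : ∀ Γ : Set Υ, Γ.Nonempty → IsEverBranching Γ → ¬ ∃ c : ℝ, ∀ t ∈ Γ, ρ t = c)
    (hgood : ∀ t, IsGoodPoint ρ t) :
    ∃ N : Seminorm ℝ C₀(Υ, ℝ), IsEquivalentNorm N ∧ IsLUR N := by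
  classical
  have hfin : ∀ t, (levelSuccessors ρ t).Finite := fun t => (hgood t).finite_levelSuccessors
  set V : Set ((ℚ ⊕ ℚ × ℕ) × Υ) → Submodule ℝ C₀(Υ, ℝ) := fun G =>
    Submodule.span ℝ (treeChi '' meetSet (pointsWithPredecessors G)) with hV
  have hVmono : ∀ G G', G ⊆ G' → V G ≤ V G' := fun G G' h =>
    Submodule.span_mono (Set.image_mono (meetSet_mono (pointsWithPredecessors_mono h)))
  refine exists_isEquivalentNorm_isLUR (treeFunctional hfin) (abs_treeFunctional_le hfin)
    (fun f η hη => finite_treeFunctional hρ hfin f hη) (fun G => V G) (fun G => ?_)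
    (fun G G' h => hVmono G G' (Finset.coe_subset.2 h)) (fun f ε hε => ?_)
  · exact FiniteDimensional.span_of_finite ℝ
      ((finite_meetSet (finite_pointsWithPredecessors G.finite_toSet)).image _)
  · set P : Set ((ℚ ⊕ ℚ × ℕ) × Υ) := {γ | treeFunctional hfin γ f ≠ 0} with hP
    have hf : f ∈ (V P).topologicalClosure := by
      refine mem_closure_span_of_functionals hρ hfin hbranch f (S := pointsWithPredecessors P)
        (fun t ht => ?_) (fun a ⟨q, hq⟩ ha => ?_)
      · obtain ⟨q, k, hqk⟩ := (hgood t).exists_mem_exitSet hρ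
        refine ⟨(Sum.inr (q, k), t), treeFunctional_ne_zero hfin ?_, Or.inl rfl⟩
        simp only [treeBaseFunctional, hqk, if_true, LinearMap.smul_apply, smul_eq_mul]
        exact mul_ne_zero (by positivity) ht
      · have hmem : ((Sum.inl q, a) : (ℚ ⊕ ℚ × ℕ) × Υ) ∈ P := treeFunctional_ne_zero hfin (by
          simpa [treeBaseFunctional, hq] using ha)
        exact ⟨⟨_, hmem, Or.inl rfl⟩, fun z hz => ⟨_, hmem, Or.inr hz⟩⟩
    obtain ⟨h, hh, hfh⟩ := Metric.mem_closure_iff.1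
      (show f ∈ closure ((V P : Submodule ℝ _) : Set C₀(Υ, ℝ)) from hf) ε hε
    rw [dist_eq_norm] at hfh
    have key : ∃ G : Finset ((ℚ ⊕ ℚ × ℕ) × Υ), ↑G ⊆ P ∧ h ∈ V G := by
      clear hfh
      have hh' : h ∈ Submodule.span ℝ (treeChi '' meetSet (pointsWithPredecessors P)) := hh
      induction hh' using Submodule.span_induction with
      | mem h hmem =>
        obtain ⟨m, hm, rfl⟩ := hmem
        obtain ⟨G, hG, hmG⟩ := exists_finset_meetSet hm
        exact ⟨G, hG, Submodule.subset_span ⟨m, hmG, rfl⟩⟩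
      | zero => exact ⟨∅, by simp, Submodule.zero_mem _⟩
      | add g h hg hh' ihg ihh =>
        obtain ⟨G, hG, hgG⟩ := ihg hg
        obtain ⟨H, hH, hhH⟩ := ihh hh'
        refine ⟨G ∪ H, by simpa using ⟨hG, hH⟩, Submodule.add_mem _ ?_ ?_⟩
        · exact hVmono _ _ (by simp) hgG
        · exact hVmono _ _ (by simp) hhH
      | smul a h hh' ih =>
        obtain ⟨G, hG, hhG⟩ := ih hh'
        exact ⟨G, hG, Submodule.smul_mem _ a hhG⟩
    obtain ⟨G, hG, hhG⟩ := key
    exact ⟨G, fun γ hγ => hG hγ, h, hhG, hfh⟩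

end TreeLUR

theorem inv_smul_sum_sub_eq {X ι : Type*} [AddCommGroup X] [Module ℝ X] {S : Finset ι} {k : ℕ}
    (hS : S.card = k) (hk : (k : ℝ) ≠ 0) (x : ι → X) (y : X) :
    (k : ℝ)⁻¹ • ∑ u ∈ S, x u - y = (k : ℝ)⁻¹ • ∑ u ∈ S, (x u - y) := by
  rw [Finset.sum_sub_distrib, Finset.sum_const, hS, smul_sub, ← Nat.cast_smul_eq_nsmul ℝ,
    smul_smul, inv_mul_cancel₀ hk, one_smul]

/-! ### The increasing function given by minimal norms of extensions. -/

section Extensions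

variable {Υ : Type*} [PartialOrder Υ] [TopologicalSpace Υ]

/-- Evaluation at a point, as a continuous linear functional on `C₀`. -/
noncomputable def c0EvalL {Υ : Type*} [TopologicalSpace Υ] (t : Υ) : StrongDual ℝ C₀(Υ, ℝ) :=
  (c0Eval t).mkContinuous 1 fun f => by simpa using c0_abs_apply_le f t

@[simp] theorem c0EvalL_apply {Υ : Type*} [TopologicalSpace Υ] (t : Υ) (f : C₀(Υ, ℝ)) :
    c0EvalL t f = f t := rfl

/-- The functions that extend `1` on `{s | s ≤ t}` and vanish off `{s | s ≤ t ∨ t ≤ s}`. -/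
def extensionSet (t : Υ) : Set C₀(Υ, ℝ) :=
  {x | (∀ s ≤ t, x s = 1) ∧ ∀ s, ¬ s ≤ t → ¬ t ≤ s → x s = 0}

theorem extensionSet_midpoint_mem {t : Υ} {x y : C₀(Υ, ℝ)} (hx : x ∈ extensionSet t)
    (hy : y ∈ extensionSet t) : (1 / 2 : ℝ) • (x + y) ∈ extensionSet t := by
  refine ⟨fun s hs => ?_, fun s h1 h2 => ?_⟩
  · simp only [ZeroAtInftyContinuousMap.smul_apply, ZeroAtInftyContinuousMap.add_apply, hx.1 s hs,
      hy.1 s hs, smul_eq_mul]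
    norm_num
  · simp only [ZeroAtInftyContinuousMap.smul_apply, ZeroAtInftyContinuousMap.add_apply,
      hx.2 s h1 h2, hy.2 s h1 h2, smul_eq_mul]
    norm_num

theorem isClosed_extensionSet (t : Υ) : IsClosed (extensionSet t) := by
  have h1 : extensionSet t = (⋂ s ∈ Set.Iic t, {x : C₀(Υ, ℝ) | c0EvalL s x = 1}) ∩
      ⋂ s ∈ {s | ¬ s ≤ t ∧ ¬ t ≤ s}, {x : C₀(Υ, ℝ) | c0EvalL s x = 0} := by
    ext x
    simp [extensionSet]
  rw [h1]
  exact (isClosed_biInter fun s _ => isClosed_eq (c0EvalL s).continuous continuous_const).inter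
    (isClosed_biInter fun s _ => isClosed_eq (c0EvalL s).continuous continuous_const)

variable (N : Seminorm ℝ C₀(Υ, ℝ))

/-- The infimum of `N` on `extensionSet t`. -/
noncomputable def extensionInf (t : Υ) : ℝ := sInf (N '' extensionSet t)

variable {N}

theorem extensionInf_le {t : Υ} {x : C₀(Υ, ℝ)} (hx : x ∈ extensionSet t) :
    extensionInf N t ≤ N x :=
  csInf_le ⟨0, by rintro _ ⟨y, -, rfl⟩; exact apply_nonneg N y⟩ ⟨x, hx, rfl⟩

theorem two_mul_extensionInf_le {t : Υ} {x y : C₀(Υ, ℝ)} (hx : x ∈ extensionSet t)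
    (hy : y ∈ extensionSet t) : 2 * extensionInf N t ≤ N (x + y) := by
  have h := extensionInf_le (N := N) (extensionSet_midpoint_mem hx hy)
  rw [map_smul_eq_mul, Real.norm_of_nonneg (by norm_num)] at h
  linarith

variable [IsHausdorffTree Υ]

theorem extensionSet_anti {t u : Υ} (h : t ≤ u) : extensionSet u ⊆ extensionSet t := by
  intro x hx
  refine ⟨fun s hs => hx.1 s (hs.trans h), fun s h1 h2 => hx.2 s (fun hsu => ?_) fun hus =>
    h2 (h.trans hus)⟩
  rcases tree_total hsu h with h3 | h3
  · exact h1 h3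
  · exact h2 h3

variable [HasTreeTopology Υ]

theorem treeChi_mem_extensionSet (t : Υ) : treeChi t ∈ extensionSet t :=
  ⟨fun _ hs => treeChi_of_le hs, fun _ h1 _ => treeChi_of_not_le h1⟩

theorem monotone_extensionInf : Monotone (extensionInf N) := fun t u h =>
  csInf_le_csInf ⟨0, by rintro _ ⟨y, -, rfl⟩; exact apply_nonneg N y⟩
    ⟨_, _, treeChi_mem_extensionSet u, rfl⟩ (Set.image_mono (extensionSet_anti h))

theorem exists_mem_extensionSet_lt {t : Υ} {c : ℝ} (h : extensionInf N t < c) :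
    ∃ x ∈ extensionSet t, N x < c := by
  obtain ⟨_, ⟨x, hx, rfl⟩, hlt⟩ :=
    exists_lt_of_csInf_lt (⟨_, _, treeChi_mem_extensionSet t, rfl⟩ : (N '' extensionSet t).Nonempty) h
  exact ⟨x, hx, hlt⟩

/-- At a bad point of `extensionInf N`, the infimum is attained at the indicator function. -/
theorem apply_treeChi_le_of_isBadPoint (hN : IsEquivalentNorm N) {t : Υ}
    (ht : IsBadPoint (extensionInf N) t) : N (treeChi t) ≤ extensionInf N t := by
  classical
  obtain ⟨c, C, hc, hC, hcC⟩ := hN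
  refine le_of_forall_pos_le_add fun ε hε => ?_
  set U : Set Υ := {u | t ⋖ u ∧ extensionInf N u < extensionInf N t + ε / 2} with hU
  have hUinf : U.Infinite := by
    intro hfin
    refine ht ⟨U, fun u hu => hu.1, hfin, ε / 2, by positivity, fun u hu => ?_⟩
    by_contra hlt
    exact hu.2 ⟨hu.1, not_le.1 hlt⟩
  choose! x hx hxN using fun u (hu : u ∈ U) => exists_mem_extensionSet_lt hu.2
  set M := (extensionInf N t + ε / 2) / c + 1 with hM
  have hbound : ∀ u ∈ U, ∀ s, |(x u - treeChi t) s| ≤ M := by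
    intro u hu s
    refine (c0_abs_apply_le _ s).trans ((norm_sub_le _ _).trans (add_le_add ?_ ?_))
    · rw [le_div_iff₀ hc, mul_comm]
      exact ((hcC _).1).trans (hxN u hu).le
    · refine c0_norm_le zero_le_one fun s => ?_
      by_cases hs : s ≤ t
      · rw [treeChi_of_le hs, abs_one]
      · rw [treeChi_of_not_le hs, abs_zero]; exact zero_le_one
  have hM0 : 0 ≤ M := by
    obtain ⟨u, hu⟩ := hUinf.nonempty
    exact (abs_nonneg _).trans (hbound u hu t)
  -- The differences live on {s ≥ u}, and these sets are disjoint for distinct successors `u`; hence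
  -- an average of `k` of them has norm at most M / k.
  have hsupp : ∀ u ∈ U, ∀ s, ¬ u ≤ s → (x u - treeChi t) s = 0 := by
    intro u hu s hus
    rw [ZeroAtInftyContinuousMap.sub_apply]
    by_cases hst : s ≤ t
    · rw [treeChi_of_le hst, (hx u hu).1 s (hst.trans hu.1.le), sub_self]
    · rw [treeChi_of_not_le hst, (hx u hu).2 s (fun hsu => ?_) hus, sub_self]
      rcases hsu.lt_or_eq with h | h
      · exact hst (tree_le_of_lt_covBy hu.1 h)
      · exact hus h.ge
  obtain ⟨k, hk⟩ := exists_nat_gt (C * M / (ε / 2))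
  have hk0 : (0 : ℝ) < k := lt_of_le_of_lt (by positivity) hk
  obtain ⟨S, hSU, hScard⟩ := hUinf.exists_subset_card_eq k
  set a : C₀(Υ, ℝ) := (k : ℝ)⁻¹ • ∑ u ∈ S, x u with ha
  have hNa : N a ≤ extensionInf N t + ε / 2 := by
    rw [ha, map_smul_eq_mul, norm_inv, RCLike.norm_natCast, inv_mul_le_iff₀ hk0]
    refine (Finset.le_sum_of_subadditive N (map_zero N).le (map_add_le_add N) S x).trans ?_
    refine (Finset.sum_le_card_nsmul _ _ _ fun u hu => (hxN u (hSU hu)).le).trans_eq ?_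
    rw [hScard, nsmul_eq_mul]
  have hdiff : ‖treeChi t - a‖ ≤ M / k := by
    rw [norm_sub_rev]
    have e1 : a - treeChi t = (k : ℝ)⁻¹ • ∑ u ∈ S, (x u - treeChi t) :=
      inv_smul_sum_sub_eq hScard hk0.ne' x (treeChi t)
    rw [e1, norm_smul, norm_inv, RCLike.norm_natCast, inv_mul_eq_div]
    refine div_le_div_of_nonneg_right (c0_norm_le hM0 fun s => ?_) hk0.le
    have e2 : (∑ u ∈ S, (x u - treeChi t)) s = ∑ u ∈ S, (x u - treeChi t) s :=
      map_sum (c0Eval s) _ _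
    rw [e2]
    by_cases hex : ∃ u ∈ S, u ≤ s
    · obtain ⟨u, hu, hus⟩ := hex
      rw [Finset.sum_eq_single_of_mem u hu fun v hv hvu => hsupp v (hSU hv) s fun hvs =>
        hvu (tree_covBy_unique (hSU hv).1 hvs (hSU hu).1 hus)]
      exact hbound u (hSU hu) s
    · rw [Finset.sum_eq_zero fun u hu => hsupp u (hSU hu) s fun hus => hex ⟨u, hu, hus⟩, abs_zero]
      exact hM0
  have h1 : N (treeChi t) ≤ N a + N (treeChi t - a) := by
    simpa using map_add_le_add N a (treeChi t - a)
  have h2 : N (treeChi t - a) ≤ ε / 2 := by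
    refine (hcC _).2.trans ((mul_le_mul_of_nonneg_left hdiff hC.le).trans ?_)
    rw [div_lt_iff₀ (by positivity)] at hk
    rw [← mul_div_assoc, div_le_iff₀ hk0]
    linarith
  linarith

/-- If `extensionInf N` is constant on an ever-branching set `Γ`, then the infimum is attained at
each point of `Γ`. -/
theorem exists_mem_extensionSet_le_of_isEverBranching (hN : IsEquivalentNorm N) {Γ : Set Υ}
    {U W : Υ → Υ} (hU : ∀ t ∈ Γ, U t ∈ Γ ∧ t ≤ U t) (hW : ∀ t ∈ Γ, W t ∈ Γ ∧ t ≤ W t)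
    (hUW : ∀ t ∈ Γ, ¬ U t ≤ W t ∧ ¬ W t ≤ U t) {c : ℝ} (hc : ∀ t ∈ Γ, extensionInf N t = c)
    {t : Υ} (ht : t ∈ Γ) : ∃ w ∈ extensionSet t, N w ≤ c := by
  obtain ⟨c₀, C, hc₀, hC, hcC⟩ := hN
  set A : (Υ → C₀(Υ, ℝ)) → Υ → C₀(Υ, ℝ) := fun z t => (1 / 2 : ℝ) • (z (U t) + z (W t)) with hA
  have hAmem : ∀ z, (∀ t ∈ Γ, z t ∈ extensionSet t) → ∀ t ∈ Γ, A z t ∈ extensionSet t :=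
    fun z hz t ht => extensionSet_midpoint_mem (extensionSet_anti (hU t ht).2 (hz _ (hU t ht).1))
      (extensionSet_anti (hW t ht).2 (hz _ (hW t ht).1))
  have hAN : ∀ z b, (∀ t ∈ Γ, N (z t) ≤ b) → ∀ t ∈ Γ, N (A z t) ≤ b := by
    intro z b hz t ht
    rw [hA, map_smul_eq_mul, Real.norm_of_nonneg (by norm_num)]
    linarith [map_add_le_add N (z (U t)) (z (W t)), hz _ (hU t ht).1, hz _ (hW t ht).1]
  -- Differences at `U t` and `W t` are supported above these incomparable points, so their supports
  -- are disjoint and averaging halves the distance.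
  have hcontr : ∀ z z' D, 0 ≤ D → (∀ t ∈ Γ, z t ∈ extensionSet t) →
      (∀ t ∈ Γ, z' t ∈ extensionSet t) → (∀ t ∈ Γ, ‖z t - z' t‖ ≤ D) →
      ∀ t ∈ Γ, ‖A z t - A z' t‖ ≤ D / 2 := by
    intro z z' D hD hz hz' hzz' t ht
    have hzero : ∀ u ∈ Γ, ∀ s, ¬ u ≤ s → (z u - z' u) s = 0 := by
      intro u hu s hus
      rw [ZeroAtInftyContinuousMap.sub_apply]
      by_cases hsu : s ≤ u
      · rw [(hz u hu).1 s hsu, (hz' u hu).1 s hsu, sub_self]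
      · rw [(hz u hu).2 s hsu hus, (hz' u hu).2 s hsu hus, sub_self]
    refine c0_norm_le (by positivity) fun s => ?_
    have e1 : (A z t - A z' t) s =
        ((z (U t) - z' (U t)) s + (z (W t) - z' (W t)) s) / 2 := by
      simp only [hA, ZeroAtInftyContinuousMap.sub_apply, ZeroAtInftyContinuousMap.smul_apply,
        ZeroAtInftyContinuousMap.add_apply, smul_eq_mul]
      ring
    rw [e1, abs_div, abs_two]
    refine div_le_div_of_nonneg_right ?_ zero_le_two
    by_cases h1 : U t ≤ s
    · rw [hzero (W t) (hW t ht).1 s fun h2 => ?_, add_zero]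
      · exact (c0_abs_apply_le _ s).trans (hzz' _ (hU t ht).1)
      · rcases tree_total h1 h2 with h3 | h3
        · exact (hUW t ht).1 h3
        · exact (hUW t ht).2 h3
    · rw [hzero (U t) (hU t ht).1 s h1, zero_add]
      exact (c0_abs_apply_le _ s).trans (hzz' _ (hW t ht).1)
  have hiter : ∀ (n : ℕ) z z' D, 0 ≤ D → (∀ t ∈ Γ, z t ∈ extensionSet t) →
      (∀ t ∈ Γ, z' t ∈ extensionSet t) → (∀ t ∈ Γ, ‖z t - z' t‖ ≤ D) →
      ∀ t ∈ Γ, ‖A^[n] z t - A^[n] z' t‖ ≤ D / 2 ^ n := by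
    intro n
    induction n with
    | zero => intro z z' D _ _ _ h; simpa using h
    | succ n ih =>
      intro z z' D hD hz hz' h t ht
      rw [Function.iterate_succ_apply, Function.iterate_succ_apply]
      refine (ih _ _ (D / 2) (by positivity) (hAmem z hz) (hAmem z' hz')
        (hcontr z z' D hD hz hz' h) t ht).trans_eq ?_
      rw [div_div, pow_succ']
  have hpos : ∀ n : ℕ, (0 : ℝ) < 1 / ((n : ℝ) + 1) := fun n => by positivity
  choose z hz hzN using fun (n : ℕ) (t : Υ) =>
    exists_mem_extensionSet_lt (N := N) (t := t) (lt_add_of_pos_right _ (hpos n))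
  have hzN' : ∀ n, ∀ t ∈ Γ, N (z n t) ≤ c + 1 / ((n : ℝ) + 1) := fun n t ht => by
    rw [← hc t ht]; exact (hzN n t).le
  have hc_nonneg : 0 ≤ c + 1 := by
    have h1 := (apply_nonneg N _).trans (hzN' 0 t ht)
    simpa using h1
  set M := (c + 1) / c₀ with hM
  have hM0 : 0 ≤ M := by positivity
  have hnorm : ∀ (n : ℕ) x, N x ≤ c + 1 / ((n : ℝ) + 1) → ‖x‖ ≤ M := by
    intro n x hx
    rw [hM, le_div_iff₀ hc₀, mul_comm]
    refine (hcC x).1.trans (hx.trans ?_)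
    have : 1 / ((n : ℝ) + 1) ≤ 1 := by
      rw [div_le_one (by positivity)]; linarith [n.cast_nonneg (α := ℝ)]
    linarith
  have hinv : ∀ n m, (∀ t ∈ Γ, A^[n] (z m) t ∈ extensionSet t) ∧
      ∀ t ∈ Γ, N (A^[n] (z m) t) ≤ c + 1 / ((m : ℝ) + 1) := by
    intro n m
    induction n with
    | zero => exact ⟨fun t _ => hz m t, hzN' m⟩
    | succ n ih =>
      rw [Function.iterate_succ_apply']
      exact ⟨hAmem _ ih.1, hAN _ _ ih.2⟩
  -- Near-minimisers at stage `n` are averaged `n` times. Consecutive terms compare `z n` with `A (z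
  -- (n + 1))`, at distance at most 2M, after `n` halvings.
  have hcauchy : CauchySeq fun n => A^[n] (z n) t := by
    refine cauchySeq_of_le_geometric_two (C := 4 * M) fun n => ?_
    rw [dist_eq_norm, Function.iterate_succ_apply]
    have h1 := hiter n (z n) (A (z (n + 1))) (2 * M) (by positivity) (fun t _ => hz n t)
      (hinv 1 (n + 1)).1 (fun t ht => (norm_sub_le _ _).trans (by
        have e1 := hnorm n _ (hzN' n t ht)
        have e2 := hnorm (n + 1) _ ((hinv 1 (n + 1)).2 t ht)
        rw [Function.iterate_one] at e2
        linarith)) t ht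
    refine h1.trans_eq ?_
    ring
  obtain ⟨w, hw⟩ := cauchySeq_tendsto_of_complete hcauchy
  refine ⟨w, (isClosed_extensionSet t).mem_of_tendsto hw
    (Eventually.of_forall fun n => (hinv n n).1 t ht), ?_⟩
  have h1 : Tendsto (fun n : ℕ => c + 1 / ((n : ℝ) + 1) + C * ‖w - A^[n] (z n) t‖) atTop
      (𝓝 (c + 0 + C * 0)) := by
    refine (tendsto_const_nhds.add tendsto_one_div_add_atTop_nhds_zero_nat).add
      (Tendsto.const_mul C ?_)
    have := (tendsto_const_nhds (x := w)).sub hw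
    rw [sub_self] at this
    exact (tendsto_zero_iff_norm_tendsto_zero).1 this
  rw [add_zero, mul_zero, add_zero] at h1
  refine ge_of_tendsto' h1 fun n => ?_
  have h2 : N w ≤ N (A^[n] (z n) t) + N (w - A^[n] (z n) t) := by
    simpa using map_add_le_add N (A^[n] (z n) t) (w - A^[n] (z n) t)
  linarith [(hinv n n).2 t ht, (hcC (w - A^[n] (z n) t)).2]

/-- Minimisers at two incomparable points above `t` both extend from `t`, so their midpoint is also
minimal and strict convexity identifies them; yet at `U t` one is 1 and the other is 0. -/
theorem extensionInf_not_constant_of_isEverBranching (hN : IsEquivalentNorm N)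
    (hstrict : ∀ x y, N x = N y → N (x + y) = 2 * N x → x = y) {Γ : Set Υ} (hne : Γ.Nonempty)
    (hΓ : IsEverBranching Γ) : ¬ ∃ c : ℝ, ∀ t ∈ Γ, extensionInf N t = c := by
  rintro ⟨c, hc⟩
  have hex : ∀ t ∈ Γ, ∃ u w, (u ∈ Γ ∧ t ≤ u) ∧ (w ∈ Γ ∧ t ≤ w) ∧ ¬ u ≤ w ∧ ¬ w ≤ u := by
    intro t ht
    by_contra hno
    push Not at hno
    refine hΓ t ht fun u hu w hw _ => ?_
    by_cases h : u ≤ w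
    · exact Or.inl h
    · exact Or.inr (hno u w hu hw h)
  choose! U W hU hW hUW using hex
  obtain ⟨t, ht⟩ := hne
  obtain ⟨u, hu, huN⟩ := exists_mem_extensionSet_le_of_isEverBranching hN hU hW hUW hc (hU t ht).1
  obtain ⟨w, hw, hwN⟩ := exists_mem_extensionSet_le_of_isEverBranching hN hU hW hUW hc (hW t ht).1
  have h1 := extensionInf_le (N := N) hu
  have h2 := extensionInf_le (N := N) hw
  have h3 := two_mul_extensionInf_le (N := N) (extensionSet_anti (hU t ht).2 hu)
    (extensionSet_anti (hW t ht).2 hw)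
  have h4 := map_add_le_add N u w
  rw [hc _ (hU t ht).1] at h1
  rw [hc _ (hW t ht).1] at h2
  rw [hc t ht] at h3
  have heq : u = w := hstrict u w (by linarith) (by linarith)
  have h5 := hu.1 (U t) le_rfl
  have h6 := hw.2 (U t) (hUW t ht).1 (hUW t ht).2
  rw [heq, h6] at h5
  exact zero_ne_one h5

end Extensions

/-! ### From weak local uniform convexity to a function without bad points. -/

section WeaklyLUR

variable {Υ : Type*} [PartialOrder Υ] [IsHausdorffTree Υ] [TopologicalSpace Υ] [HasTreeTopology Υ]
  {N : Seminorm ℝ C₀(Υ, ℝ)}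

/-- Otherwise μ(s n) → μ(t) along bad points below `t`. At bad points the norm of the indicator
equals μ, and χ_t also extends from `s n`, so the hypotheses of weak LUR hold for χ_t and χ_{s n};
but evaluation at `t` gives 1 and 0. -/
theorem exists_rat_separating_of_isWeaklyLUR (hN : IsEquivalentNorm N) (hw : IsWeaklyLUR N) {t : Υ}
    (ht : IsBadPoint (extensionInf N) t) :
    ∃ q : ℚ, (∀ s < t, IsBadPoint (extensionInf N) s → extensionInf N s < q) ∧
      (q : ℝ) < extensionInf N t := by
  by_contra hno
  push Not at hno
  have hval : ∀ s, IsBadPoint (extensionInf N) s → N (treeChi s) = extensionInf N s := fun s hs =>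
    le_antisymm (apply_treeChi_le_of_isBadPoint hN hs) (extensionInf_le (treeChi_mem_extensionSet s))
  have hseq : ∀ n : ℕ, ∃ s < t, IsBadPoint (extensionInf N) s ∧
      extensionInf N t - 1 / ((n : ℝ) + 1) < extensionInf N s := by
    intro n
    have hn : (0 : ℝ) < 1 / ((n : ℝ) + 1) := by positivity
    obtain ⟨q, hq1, hq2⟩ := exists_rat_btwn (sub_lt_self (extensionInf N t) hn)
    by_contra hno'
    push Not at hno'
    exact absurd hq2 (not_lt.2 (hno q fun s hs hb => (hno' s hs hb).trans_lt hq1))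
  choose s hst hbad hs using hseq
  have hlim : Tendsto (fun n => extensionInf N (s n)) atTop (𝓝 (extensionInf N t)) := by
    have h1 : Tendsto (fun n : ℕ => extensionInf N t - 1 / ((n : ℝ) + 1)) atTop
        (𝓝 (extensionInf N t - 0)) :=
      tendsto_const_nhds.sub tendsto_one_div_add_atTop_nhds_zero_nat
    rw [sub_zero] at h1
    exact tendsto_of_tendsto_of_tendsto_of_le_of_le h1 tendsto_const_nhds (fun n => (hs n).le)
      (fun n => monotone_extensionInf (hst n).le)
  have hconv := hw (treeChi t) (fun n => treeChi (s n))
    (by simpa only [hval t ht, hval _ (hbad _)] using hlim)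
    (by
      have hup : Tendsto (fun n => extensionInf N t + extensionInf N (s n)) atTop
          (𝓝 (2 * extensionInf N t)) := by
        rw [two_mul]
        exact tendsto_const_nhds.add hlim
      rw [hval t ht]
      refine tendsto_of_tendsto_of_tendsto_of_le_of_le (hlim.const_mul 2) hup (fun n => ?_)
        (fun n => ?_)
      · exact two_mul_extensionInf_le (extensionSet_anti (hst n).le (treeChi_mem_extensionSet t))
          (treeChi_mem_extensionSet (s n))
      · have h2 := map_add_le_add N (treeChi t) (treeChi (s n))
        rwa [hval t ht, hval _ (hbad n)] at h2)
    (c0EvalL t)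
  simp only [c0EvalL_apply, treeChi_of_le (le_refl t), treeChi_of_not_le (hst _).not_ge] at hconv
  exact zero_ne_one (tendsto_nhds_unique tendsto_const_nhds hconv)

theorem exists_monotone_of_isWeaklyLUR (hN : IsEquivalentNorm N) (hw : IsWeaklyLUR N) :
    ∃ ρ : Υ → ℝ, Monotone ρ ∧
      (∀ Γ : Set Υ, Γ.Nonempty → IsEverBranching Γ → ¬ ∃ c : ℝ, ∀ t ∈ Γ, ρ t = c) ∧
      (∀ t : Υ, ¬ IsBadPoint ρ t) := by
  classical
  set μ := extensionInf N with hμ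
  have hμmono : Monotone μ := monotone_extensionInf
  have hstrict : ∀ x y, N x = N y → N (x + y) = 2 * N x → x = y := by
    intro x y h1 h2
    ext s
    have h3 := hw x (fun _ => y) (by rw [h1]; exact tendsto_const_nhds)
      (by rw [h2]; exact tendsto_const_nhds) (c0EvalL s)
    exact tendsto_nhds_unique h3 tendsto_const_nhds
  choose! q hq1 hq2 using fun t (ht : IsBadPoint μ t) => exists_rat_separating_of_isWeaklyLUR hN hw ht
  set w : ℚ → ℝ := fun r => (1 / 2 : ℝ) ^ Encodable.encode r with hw_def
  have hwpos : ∀ r, 0 < w r := fun r => by positivity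
  have hwsum : Summable w := summable_geometric_two_encode
  -- Along a chain of bad points the rationals `q` strictly increase, so passing a bad `t` adds the
  -- new rational `q t` to `below` and `σ` grows by at least its weight.
  set below : Υ → Set ℚ := fun t => {r | ∃ s < t, IsBadPoint μ s ∧ q s = r} with hbelow
  have hbelow_mono : Monotone below := fun t u h r ⟨s, hs, h'⟩ => ⟨s, hs.trans_le h, h'⟩
  set σ : Υ → ℝ := fun t => ∑' r, (below t).indicator w r with hσ
  have hσsum : ∀ t, Summable ((below t).indicator w) := fun t => hwsum.indicator _
  have hσmono : Monotone σ := fun t u h => (hσsum t).tsum_le_tsum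
    (Set.indicator_le_indicator_of_subset (hbelow_mono h) fun r => (hwpos r).le) (hσsum u)
  have hjump : ∀ t u, IsBadPoint μ t → t < u → σ t + w (q t) ≤ σ u := by
    intro t u ht htu
    have hnot : q t ∉ below t := by
      rintro ⟨s, hs, hsb, hqs⟩
      have h1 := hq1 t ht s hs hsb
      have h2 := hq2 s hsb
      rw [hqs] at h2
      exact lt_asymm h1 h2
    have hmem : q t ∈ below u := ⟨t, htu, ht, rfl⟩
    have h1 : HasSum (fun r => (below t).indicator w r + if r = q t then w (q t) else 0)
        (σ t + w (q t)) := (hσsum t).hasSum.add (hasSum_ite_eq (q t) (w (q t)))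
    refine hasSum_le (fun r => ?_) h1 (hσsum u).hasSum
    by_cases hr : r = q t
    · rw [hr, Set.indicator_of_notMem hnot, Set.indicator_of_mem hmem, if_pos rfl, zero_add]
    · rw [if_neg hr, add_zero]
      exact Set.indicator_le_indicator_of_subset (hbelow_mono htu.le) (fun r => (hwpos r).le) r
  refine ⟨fun t => μ t + σ t, hμmono.add hσmono, ?_, fun t hbad => hbad ?_⟩
  · rintro Γ ⟨t, ht⟩ hΓ ⟨c, hc⟩
    -- Constancy of the sum μ + σ gives constancy of μ only among points comparable with a fixed
    -- `t`, hence the restriction to `Γ ∩ Set.Ici t`.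
    refine extensionInf_not_constant_of_isEverBranching hN hstrict (Γ := Γ ∩ Set.Ici t)
      ⟨t, ht, le_rfl⟩ (fun u hu hchain => hΓ u hu.1 ?_) ⟨μ t, fun u hu => ?_⟩
    · have h1 : Γ ∩ Set.Ici t ∩ Set.Ici u = Γ ∩ Set.Ici u := by
        ext z
        exact ⟨fun h => ⟨h.1.1, h.2⟩, fun h => ⟨⟨h.1, hu.2.trans h.2⟩, h.2⟩⟩
      rwa [h1] at hchain
    · have h1 := hc t ht
      have h2 := hc u hu.1
      have h3 := hμmono hu.2
      have h4 := hσmono hu.2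
      simp only at h1 h2
      exact le_antisymm (by linarith) h3
  · by_cases ht : IsBadPoint μ t
    · refine ⟨∅, Set.empty_subset _, Set.finite_empty, w (q t), hwpos _, fun u hu => ?_⟩
      have h1 : t ⋖ u := hu.1
      have h2 := hjump t u ht h1.lt
      have h3 := hμmono h1.le
      change μ t + σ t + w (q t) ≤ μ u + σ u
      linarith
    · obtain ⟨F, hF, hFfin, δ, hδ, hu⟩ := not_not.1 ht
      refine ⟨F, hF, hFfin, δ, hδ, fun u huF => ?_⟩
      have h1 : t ⋖ u := huF.1
      have h2 := hu u huF
      have h3 := hσmono h1.le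
      change μ t + σ t + δ ≤ μ u + σ u
      linarith

end WeaklyLUR

theorem IsLUR.isWeaklyLUR {X : Type*} [NormedAddCommGroup X] [NormedSpace ℝ X] {N : Seminorm ℝ X}
    (hN : IsEquivalentNorm N) (h : IsLUR N) : IsWeaklyLUR N := by
  intro x y h1 h2 φ
  obtain ⟨c, C, hc, hC, hcC⟩ := hN
  have h3 : Tendsto (fun n => c⁻¹ * N (x - y n)) atTop (𝓝 0) := by
    simpa using (h x y h1 h2).const_mul c⁻¹
  have h4 : Tendsto (fun n => y n - x) atTop (𝓝 0) := by
    refine squeeze_zero_norm (fun n => ?_) h3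
    rw [norm_sub_rev, inv_mul_eq_div, le_div_iff₀ hc, mul_comm]
    exact (hcC _).1
  have h5 := (φ.continuous.tendsto x).comp (tendsto_sub_nhds_zero_iff.1 h4)
  exact h5

theorem theorem4p1 (Υ : Type*) [PartialOrder Υ] [IsHausdorffTree Υ]
    [TopologicalSpace Υ] [HasTreeTopology Υ] :
    List.TFAE [
      ∃ N : Seminorm ℝ C₀(Υ, ℝ), IsEquivalentNorm N ∧ IsLUR N,
      ∃ N : Seminorm ℝ C₀(Υ, ℝ), IsEquivalentNorm N ∧ IsWeaklyLUR N,
      ∃ ρ : Υ → ℝ, Monotone ρ ∧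
        (∀ Γ : Set Υ, Γ.Nonempty → IsEverBranching Γ → ¬ ∃ c : ℝ, ∀ t ∈ Γ, ρ t = c) ∧
        (∀ t : Υ, ¬ IsBadPoint ρ t)] := by
  tfae_have 1 → 2 := fun ⟨N, hN, h⟩ => ⟨N, hN, h.isWeaklyLUR hN⟩
  tfae_have 2 → 3 := fun ⟨_, hN, h⟩ => exists_monotone_of_isWeaklyLUR hN h
  tfae_have 3 → 1 := fun ⟨_, hρ, hbranch, hgood⟩ =>
    exists_isLUR_of_monotone hρ hbranch fun t => not_not.1 (hgood t)
  tfae_finish
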